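/- **Definitions.** Let $n>2$ and let $(x_1,y_1),\dots,(x_n,y_n)$ be pairs of real numbers such that the $y_i$ are not all equal. List the pairs in an order in which $x_1\le x_2\le\dots\le x_n$ (if there are ties among the $x_i$, this involves choosing one of several such orders). Let $r_i$ be the number of $j$ with $y_j\le y_i$ and $l_i$ the number of $j$ with $y_j\ge y_i$, and put $$\xi_n(\vec x,\vec y)=1-\frac{n\sum_{i=1}^{n-1}|r_{i+1}-r_i|}{2\sum_{i=1}^n l_i(n-l_i)},\qquad \xi'_n(\vec x,\vec y)=\max\left\{-1,\frac{\xi_n(\vec x,\vec y)}{\xi_n(\vec y,\vec y)}\right\},$$ where $\xi_n(\vec y,\vec y)$ is the value for the pairs $(y_i,y_i)$, which does not depend on how ties are broken. For real random variables $X,Y$ with $Y$ not almost surely constant, let $$\xi(X,Y)=\frac{\int \operatorname{Var}\big(E(1_{\{Y\ge t\}}\mid X)\big)\,d\mu(t)}{\int \operatorname{Var}\big(1_{\{Y\ge t\}}\big)\,d\mu(t)},$$ where $\mu$ is the law of $Y$. **Theorem.** The normalized estimator $\xi'_n$ has the following properties. (a) It is an asymptotically unbiased estimator of $\xi$: let $(x_1,y_1),(x_2,y_2),\dots$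 be i.i.d. pairs with the law of $(X,Y)$, where $X,Y$ are real random variables and $Y$ is not almost surely constant, and for each $n$ let ties among $x_1,\dots,x_n$ be broken uniformly at random (given the data, the order of the sample is uniformly distributed on all orders that sort $x_1,\dots,x_n$). Then the expectation of $\xi'_n$ converges to $\xi(X,Y)$ as $n\to\infty$. This holds for the conditional expectation given that $y_1,\dots,y_n$ are not all equal, and also for the unconditional expectation if $\xi'_n$ is given an arbitrary fixed real value $c$ on the samples with $y_1=\dots=y_n$. For all $n>2$, all real $x_1,\dots,x_n$, all real $y_1,\dots,y_n$ that are not all equal, and every way of breaking ties among the $x_i$: (b) $|\xi'_n|\le 1$; (c) $\operatorname{sign}(\xi'_n)=\operatorname{sign}(\xi_n)$; (d) if $\xi_n\ge 0$, then $\xi'_n\ge\xi_n$. -/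

import Mathlib

open MeasureTheory ProbabilityTheory Filter Topology

noncomputable section

/-- The rank `r_i`: the number of values among `y_1, …, y_n` that are at most `y_i`. -/
def rankLE {n : ℕ} (y : Fin n → ℝ) (i : Fin n) : ℕ :=
  {j : Fin n | y j ≤ y i}.ncard

/-- The number `l_i` of values among `y_1, …, y_n` that are at least `y_i`. -/
def rankGE {n : ℕ} (y : Fin n → ℝ) (i : Fin n) : ℕ :=
  {j : Fin n | y i ≤ y j}.ncard

/-- Chatterjee's formula for values `y_1, …, y_n` that are already listed in the order of
increasing `x`. It is meaningful when the `y_i` are not all equal. -/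
def xiFormula {n : ℕ} (y : Fin n → ℝ) : ℝ :=
  1 - ((n : ℝ) * ∑ i : Fin (n - 1),
        |(rankLE y ⟨i + 1, by omega⟩ : ℝ) - (rankLE y ⟨i, by omega⟩ : ℝ)|) /
      (2 * ∑ i : Fin n, (rankGE y i : ℝ) * ((n : ℝ) - (rankGE y i : ℝ)))

/-- `σ` lists the indices of the sample in an order with `x_{σ 1} ≤ x_{σ 2} ≤ … ≤ x_{σ n}`.
Several such `σ` exist exactly if there are ties among the `x_i`; choosing one of them is
breaking the ties. -/
def IsOrdering {n : ℕ} (x : Fin n → ℝ) (σ : Equiv.Perm (Fin n)) : Prop :=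
  Monotone (x ∘ σ)

/-- Chatterjee's correlation `ξ_n(x, y)` of the sample `(x_i, y_i)`, where the vector `x` enters
through an ordering `σ` of it (`IsOrdering x σ`). -/
def xiN {n : ℕ} (y : Fin n → ℝ) (σ : Equiv.Perm (Fin n)) : ℝ :=
  xiFormula (y ∘ σ)

/-- `ξ_n(y, y)`: here `y` itself is the vector that determines the order. -/
def xiSelf {n : ℕ} (y : Fin n → ℝ) : ℝ :=
  xiN y (Tuple.sort y)

/-- `ξ_n(y, y)` does not depend on the way in which ties are broken. -/
theorem xiN_eq_xiSelf {n : ℕ} (y : Fin n → ℝ) (τ : Equiv.Perm (Fin n)) (h : IsOrdering y τ) :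
    xiN y τ = xiSelf y := by
  have h2 : y ∘ τ = y ∘ Tuple.sort y := Tuple.unique_monotone h (Tuple.monotone_sort y)
  unfold xiSelf xiN
  rw [h2]

/-- The normalized estimator `ξ'_n(x, y) = max {-1, ξ_n(x, y) / ξ_n(y, y)}`, where `σ` is an
ordering of `x`. It is meaningful when `n > 2` and the `y_i` are not all equal. -/
def xiNormalized {n : ℕ} (y : Fin n → ℝ) (σ : Equiv.Perm (Fin n)) : ℝ :=
  max (-1) (xiN y σ / xiSelf y)

/-- The population quantity
`ξ(X, Y) = ∫ Var(E(1_{Y ≥ t} | X)) dμ(t) / ∫ Var(1_{Y ≥ t}) dμ(t)`, with `μ` the law of `Y`. -/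
def xiPop {Ω : Type*} [MeasurableSpace Ω] (P : Measure Ω) (X Y : Ω → ℝ) : ℝ :=
  (∫ t, variance
      (P[Set.indicator {ω | t ≤ Y ω} (fun _ => (1 : ℝ)) | MeasurableSpace.comap X inferInstance]) P
        ∂(P.map Y)) /
    (∫ t, variance (Set.indicator {ω | t ≤ Y ω} (fun _ => (1 : ℝ))) P ∂(P.map Y))

open Classical in
/-- The random permutation `σ` breaks the ties among the random `x_i` uniformly at random:
conditionally on the data `(x, y)`, it is uniformly distributed on the set of orderings of `x`. -/
def IsUniformTieBreaking {Ω : Type*} [MeasurableSpace Ω] (P : Measure Ω) {n : ℕ}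
    (x y : Ω → Fin n → ℝ) (σ : Ω → Equiv.Perm (Fin n)) : Prop :=
  ∀ π : Equiv.Perm (Fin n),
    MeasurableSet {ω | σ ω = π} ∧
    P[Set.indicator {ω | σ ω = π} (fun _ => (1 : ℝ)) |
        MeasurableSpace.comap (fun ω => (x ω, y ω)) inferInstance]
      =ᵐ[P] fun ω =>
        if IsOrdering (x ω) π then
          (({τ : Equiv.Perm (Fin n) | IsOrdering (x ω) τ}.ncard : ℝ))⁻¹
        else 0

/-- The estimators `T n`, with `μ n` the probability measure that governs samples of size `n`,
are asymptotically unbiased for `θ`: their expectations exist for large `n` and converge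
to `θ`. -/
def AsymptoticallyUnbiased {Ω : Type*} [MeasurableSpace Ω] (μ : ℕ → Measure Ω)
    (T : ℕ → Ω → ℝ) (θ : ℝ) : Prop :=
  (∀ᶠ n in atTop, Integrable (T n) (μ n)) ∧
    Tendsto (fun n => ∫ ω, T n ω ∂(μ n)) atTop (𝓝 θ)

/-- The values `y_1, …, y_n` are not all identical. -/
def NotAllEqual {n : ℕ} (y : Fin n → ℝ) : Prop :=
  ∃ i j, y i ≠ y j

end

/-! Write `R` for the total variation of the ranks along the order, `R₀` for its value when `y`
itself is sorted, and `S = ∑ l_i (n - l_i)`. Then `ξ_n = (2S - nR) / (2S)`, so `ξ'_n = max (-1) ((2S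
- nR) / (2S - nR₀))`. Any order passes through both a largest and a smallest value, so `R₀ ≤ R`; a
count gives `nR₀ < 2S` for `n > 2`. Hence `0 < ξ_n(y, y) ≤ 1` and `ξ_n ≤ ξ_n(y, y)`, from which (b),
(c), (d) are immediate (`xiNormalized_properties`).

For (a), the point is that `S / n³` and `R / n²` converge in `L¹` to constants `D` and `V` with
`ξ(X, Y) = (2D - V) / (2D)`, while `R₀ ≤ n` is negligible. As the ratio is truncated to `[-1, 1]`,
its error is bounded pointwise and linearly by the errors of `S / n³` and `R / n²`
(`abs_max_neg_one_div_sub_le`), so convergence in `L¹` suffices. The same bound exceeds 1 on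
constant samples and so makes their probability vanish.

The limit of `S` is a law of large numbers. For `R`, the ranks are replaced by `n F(y_i)` with `F`
the distribution function of `Y`, and `|F a - F b|` is the `μ`-integral over `t` of the squared
difference of the indicators `1_{t ≤ a}` and `1_{t ≤ b}`. For fixed `t`, expanding the squares
leaves products of neighbouring indicators. The noise `1_{t ≤ y} - h t x`, with `h t x = P(Y ≥ t | X
= x)`, has conditional mean zero and the order depends on the data only through `x`; orthogonality
(`integral_mul_noise_eq_zero`) therefore replaces each product by `h t x_i * h t x_{i+1}`.
Neighbouring `x` are mostly close: approximating `h t` in `L¹` by a continuous function of compact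
support (`exists_approx_small_variation`) turns this into `(h t x_i)²`, whose average converges. -/

/-! ### Increments along finite sequences, and ranks. -/

theorem abs_sub_le_sum_abs_succ_sub {m : ℕ} (f : Fin (m + 1) → ℝ) (a b : Fin (m + 1)) :
    |f a - f b| ≤ ∑ i : Fin m, |f i.succ - f i.castSucc| := by
  wlog hab : a ≤ b generalizing a b
  · rw [abs_sub_comm]
    exact this b a (le_of_not_ge hab)
  -- The default value 0 is never used: the sums below only involve indices up to `m`.
  let g : ℕ → ℝ := fun k => if h : k < m + 1 then f ⟨k, h⟩ else 0
  have hg : ∀ i : Fin (m + 1), g i = f i := fun i => dif_pos i.2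
  have h1 := dist_le_Ico_sum_dist g (show (a : ℕ) ≤ b from hab)
  rw [hg, hg, Real.dist_eq] at h1
  refine h1.trans ?_
  have h2 : ∑ i : Fin m, |f i.succ - f i.castSucc| =
      ∑ i ∈ Finset.range m, dist (g i) (g (i + 1)) := by
    rw [Finset.sum_range]
    refine Finset.sum_congr rfl fun i _ => ?_
    rw [dist_comm, Real.dist_eq, ← hg i.succ, ← hg i.castSucc]
    simp
  rw [h2]
  refine Finset.sum_le_sum_of_subset_of_nonneg ?_ fun _ _ _ => dist_nonneg
  intro k hk
  simp only [Finset.mem_Ico, Finset.mem_range] at hk ⊢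
  have := b.2
  omega

theorem sum_succ_sub_castSucc {m : ℕ} (f : Fin (m + 1) → ℝ) :
    ∑ i : Fin m, (f i.succ - f i.castSucc) = f (Fin.last m) - f 0 := by
  have h1 := Fin.sum_univ_succ f
  have h2 := Fin.sum_univ_castSucc f
  rw [Finset.sum_sub_distrib]
  linarith

theorem sum_abs_succ_sub_of_monotone {m : ℕ} {f : Fin (m + 1) → ℝ} (hf : Monotone f) :
    ∑ i : Fin m, |f i.succ - f i.castSucc| = f (Fin.last m) - f 0 := by
  rw [← sum_succ_sub_castSucc]
  refine Finset.sum_congr rfl fun i _ => abs_of_nonneg (sub_nonneg.2 (hf ?_))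
  exact (Fin.castSucc_lt_succ).le

theorem rankLE_eq_sum {n : ℕ} (y : Fin n → ℝ) (i : Fin n) :
    (rankLE y i : ℝ) = ∑ j, if y j ≤ y i then 1 else 0 := by
  classical
  rw [rankLE, Set.ncard_eq_toFinset_card', Finset.sum_boole]
  congr 2
  ext j
  simp

theorem rankGE_eq_sum {n : ℕ} (y : Fin n → ℝ) (i : Fin n) :
    (rankGE y i : ℝ) = ∑ j, if y i ≤ y j then 1 else 0 := by
  classical
  rw [rankGE, Set.ncard_eq_toFinset_card', Finset.sum_boole]
  congr 2
  ext j
  simp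

theorem rankLE_comp {n : ℕ} (y : Fin n → ℝ) (σ : Equiv.Perm (Fin n)) (i : Fin n) :
    rankLE (y ∘ σ) i = rankLE y (σ i) := by
  have : (rankLE (y ∘ σ) i : ℝ) = rankLE y (σ i) := by
    rw [rankLE_eq_sum, rankLE_eq_sum]
    exact Equiv.sum_comp σ fun j => if y j ≤ y (σ i) then (1 : ℝ) else 0
  exact_mod_cast this

theorem rankGE_comp {n : ℕ} (y : Fin n → ℝ) (σ : Equiv.Perm (Fin n)) (i : Fin n) :
    rankGE (y ∘ σ) i = rankGE y (σ i) := by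
  have : (rankGE (y ∘ σ) i : ℝ) = rankGE y (σ i) := by
    rw [rankGE_eq_sum, rankGE_eq_sum]
    exact Equiv.sum_comp σ fun j => if y (σ i) ≤ y j then (1 : ℝ) else 0
  exact_mod_cast this

theorem rankLE_mono {n : ℕ} (y : Fin n → ℝ) {i j : Fin n} (h : y i ≤ y j) :
    rankLE y i ≤ rankLE y j :=
  Set.ncard_le_ncard (fun _ hk => le_trans hk h) (Set.toFinite _)

theorem rankLE_le {n : ℕ} (y : Fin n → ℝ) (i : Fin n) : rankLE y i ≤ n := by
  simpa [rankLE] using Set.ncard_le_card {j : Fin n | y j ≤ y i}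

theorem rankGE_le {n : ℕ} (y : Fin n → ℝ) (i : Fin n) : rankGE y i ≤ n := by
  simpa [rankGE] using Set.ncard_le_card {j : Fin n | y i ≤ y j}

theorem one_le_rankGE {n : ℕ} (y : Fin n → ℝ) (i : Fin n) : 1 ≤ rankGE y i :=
  (Set.ncard_pos (Set.toFinite _)).2 ⟨i, le_refl (y i)⟩

theorem rankGE_lt {n : ℕ} (y : Fin n → ℝ) {i j : Fin n} (h : y j < y i) : rankGE y i < n := by
  have : rankGE y i < (Set.univ : Set (Fin n)).ncard :=
    Set.ncard_lt_ncard ⟨Set.subset_univ _, fun hs => absurd (hs (Set.mem_univ j)) (not_le.2 h)⟩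
  simpa [Set.ncard_univ] using this

/-! ### Rank variation, rank spread and the finite-sample claims. -/

/-- The total variation of the ranks along the order `σ`. -/
noncomputable def rankVariation {m : ℕ} (y : Fin (m + 1) → ℝ) (σ : Equiv.Perm (Fin (m + 1))) : ℝ :=
  ∑ i : Fin m, |(rankLE y (σ i.succ) : ℝ) - rankLE y (σ i.castSucc)|

/-- The sum `∑ l_i (n - l_i)`. -/
noncomputable def rankSpread {n : ℕ} (y : Fin n → ℝ) : ℝ :=
  ∑ i : Fin n, (rankGE y i : ℝ) * ((n : ℝ) - (rankGE y i : ℝ))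

theorem xiN_eq {m : ℕ} (y : Fin (m + 1) → ℝ) (σ : Equiv.Perm (Fin (m + 1))) :
    xiN y σ = 1 - ((m + 1 : ℕ) : ℝ) * rankVariation y σ / (2 * rankSpread y) := by
  have h1 : xiN y σ = 1 - (((m + 1 : ℕ) : ℝ) * ∑ i : Fin m,
      |(rankLE (y ∘ σ) i.succ : ℝ) - (rankLE (y ∘ σ) i.castSucc : ℝ)|) /
      (2 * ∑ i : Fin (m + 1), (rankGE (y ∘ σ) i : ℝ) *
        (((m + 1 : ℕ) : ℝ) - (rankGE (y ∘ σ) i : ℝ))) := rfl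
  rw [h1]
  simp only [rankLE_comp, rankGE_comp]
  rw [rankVariation, rankSpread,
    Equiv.sum_comp σ (fun i => (rankGE y i : ℝ) * (((m + 1 : ℕ) : ℝ) - (rankGE y i : ℝ)))]

theorem rankVariation_sort {m : ℕ} (y : Fin (m + 1) → ℝ) :
    rankVariation y (Tuple.sort y) =
      rankLE y (Tuple.sort y (Fin.last m)) - rankLE y (Tuple.sort y 0) := by
  refine sum_abs_succ_sub_of_monotone (f := fun i => (rankLE y (Tuple.sort y i) : ℝ)) ?_
  intro i j hij
  exact Nat.cast_le.2 (rankLE_mono y (Tuple.monotone_sort y hij))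

theorem rankVariation_nonneg {m : ℕ} (y : Fin (m + 1) → ℝ) (σ : Equiv.Perm (Fin (m + 1))) :
    0 ≤ rankVariation y σ :=
  Finset.sum_nonneg fun _ _ => abs_nonneg _

/-- The sorted variation telescopes to the largest rank minus the smallest, and every order visits
both of these positions. -/
theorem rankVariation_sort_le {m : ℕ} (y : Fin (m + 1) → ℝ) (σ : Equiv.Perm (Fin (m + 1))) :
    rankVariation y (Tuple.sort y) ≤ rankVariation y σ := by
  rw [rankVariation_sort]
  have := abs_sub_le_sum_abs_succ_sub (fun i => (rankLE y (σ i) : ℝ))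
    (σ.symm (Tuple.sort y (Fin.last m))) (σ.symm (Tuple.sort y 0))
  simp only [Equiv.apply_symm_apply] at this
  exact (le_abs_self _).trans this

theorem rankVariation_sort_le_card {m : ℕ} (y : Fin (m + 1) → ℝ) :
    rankVariation y (Tuple.sort y) ≤ ((m + 1 : ℕ) : ℝ) := by
  rw [rankVariation_sort]
  have h1 : (rankLE y (Tuple.sort y (Fin.last m)) : ℝ) ≤ ((m + 1 : ℕ) : ℝ) :=
    Nat.cast_le.2 (rankLE_le y _)
  have h2 : (0 : ℝ) ≤ rankLE y (Tuple.sort y 0) := Nat.cast_nonneg _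
  linarith

/-- Let `A` be the set of indices with non-minimal value. The sorted variation is at most `n` minus
the smallest rank, which is `|A|`. Each `i ∈ A` has `1 ≤ l_i ≤ n - 1`, so `l_i (n - l_i) ≥ n - 1`.
Thus `2S ≥ 2 (n - 1) |A| > n |A|`, the last step being where `n > 2` is needed. -/
theorem mul_rankVariation_sort_lt {m : ℕ} (hm : 2 < m + 1) (y : Fin (m + 1) → ℝ)
    (hy : NotAllEqual y) :
    ((m + 1 : ℕ) : ℝ) * rankVariation y (Tuple.sort y) < 2 * rankSpread y := by
  classical
  set i₀ := Tuple.sort y 0 with hi₀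
  have hmin : ∀ i, y i₀ ≤ y i := fun i => by
    have := Tuple.monotone_sort y (Fin.zero_le ((Tuple.sort y).symm i))
    simpa using this
  set A : Finset (Fin (m + 1)) := {i | y i₀ < y i} with hA
  have hcard : (rankLE y i₀ : ℝ) + A.card = ((m + 1 : ℕ) : ℝ) := by
    rw [rankLE_eq_sum, hA, Finset.sum_boole, ← Nat.cast_add]
    have := Finset.card_filter_add_card_filter_not (s := (Finset.univ : Finset (Fin (m + 1))))
      (fun i => y i ≤ y i₀)
    simp only [not_le] at this
    rw [this]
    simp
  have hpos : 0 < A.card := by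
    rw [Finset.card_pos]
    by_contra hne
    rw [Finset.not_nonempty_iff_eq_empty, hA, Finset.filter_eq_empty_iff] at hne
    obtain ⟨i, j, hij⟩ := hy
    have heq : ∀ i, y i = y i₀ := fun i => le_antisymm (not_lt.1 (hne (Finset.mem_univ i))) (hmin i)
    exact hij ((heq i).trans (heq j).symm)
  have hle : (A.card : ℝ) * m ≤ rankSpread y := by
    rw [rankSpread, ← nsmul_eq_mul, ← Finset.sum_const]
    refine (Finset.sum_le_sum fun i hi => ?_).trans
      (Finset.sum_le_sum_of_subset_of_nonneg (Finset.subset_univ A) fun i _ _ => ?_)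
    · have hi' : y i₀ < y i := by simpa [hA] using hi
      have h1 : (1 : ℝ) ≤ rankGE y i := by exact_mod_cast one_le_rankGE y i
      have h2 : (rankGE y i : ℝ) + 1 ≤ ((m + 1 : ℕ) : ℝ) := by
        exact_mod_cast rankGE_lt y hi'
      push_cast at h2 ⊢
      nlinarith
    · have h2 : (rankGE y i : ℝ) ≤ ((m + 1 : ℕ) : ℝ) := by exact_mod_cast rankGE_le y i
      exact mul_nonneg (Nat.cast_nonneg _) (sub_nonneg.2 h2)
  have hlast : (rankLE y (Tuple.sort y (Fin.last m)) : ℝ) ≤ ((m + 1 : ℕ) : ℝ) :=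
    Nat.cast_le.2 (rankLE_le y _)
  have hvar : rankVariation y (Tuple.sort y) ≤ A.card := by
    rw [rankVariation_sort]
    linarith
  have hpos' : (0 : ℝ) < A.card := by exact_mod_cast hpos
  have hm' : (1 : ℝ) < m := by exact_mod_cast (by omega : 1 < m)
  have h3 := mul_le_mul_of_nonneg_left hvar (Nat.cast_nonneg (α := ℝ) (m + 1))
  push_cast at h3 ⊢
  nlinarith

theorem rankSpread_pos {m : ℕ} (hm : 2 < m + 1) (y : Fin (m + 1) → ℝ) (hy : NotAllEqual y) :
    0 < rankSpread y := by
  have h1 := mul_rankVariation_sort_lt hm y hy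
  have h2 := mul_nonneg (Nat.cast_nonneg (α := ℝ) (m + 1)) (rankVariation_nonneg y (Tuple.sort y))
  linarith

theorem xiN_eq_div {m : ℕ} (hm : 2 < m + 1) (y : Fin (m + 1) → ℝ) (hy : NotAllEqual y)
    (σ : Equiv.Perm (Fin (m + 1))) :
    xiN y σ = (2 * rankSpread y - ((m + 1 : ℕ) : ℝ) * rankVariation y σ) / (2 * rankSpread y) := by
  have := rankSpread_pos hm y hy
  rw [xiN_eq]
  field_simp

theorem xiSelf_pos {m : ℕ} (hm : 2 < m + 1) (y : Fin (m + 1) → ℝ) (hy : NotAllEqual y) :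
    0 < xiSelf y := by
  rw [xiSelf, xiN_eq_div hm y hy]
  exact div_pos (sub_pos.2 (mul_rankVariation_sort_lt hm y hy))
    (mul_pos two_pos (rankSpread_pos hm y hy))

theorem xiSelf_le_one {m : ℕ} (hm : 2 < m + 1) (y : Fin (m + 1) → ℝ) (hy : NotAllEqual y) :
    xiSelf y ≤ 1 := by
  have h1 := rankSpread_pos hm y hy
  have h2 := mul_nonneg (Nat.cast_nonneg (α := ℝ) (m + 1)) (rankVariation_nonneg y (Tuple.sort y))
  rw [xiSelf, xiN_eq_div hm y hy, div_le_one (by positivity)]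
  linarith

theorem xiN_le_xiSelf {m : ℕ} (hm : 2 < m + 1) (y : Fin (m + 1) → ℝ) (hy : NotAllEqual y)
    (σ : Equiv.Perm (Fin (m + 1))) : xiN y σ ≤ xiSelf y := by
  have h1 := rankSpread_pos hm y hy
  have h2 := mul_le_mul_of_nonneg_left (rankVariation_sort_le y σ)
    (Nat.cast_nonneg (α := ℝ) (m + 1))
  rw [xiSelf, xiN_eq_div hm y hy, xiN_eq_div hm y hy]
  gcongr

theorem xiNormalized_eq {m : ℕ} (hm : 2 < m + 1) (y : Fin (m + 1) → ℝ) (hy : NotAllEqual y)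
    (σ : Equiv.Perm (Fin (m + 1))) :
    xiNormalized y σ = max (-1) ((2 * rankSpread y - ((m + 1 : ℕ) : ℝ) * rankVariation y σ) /
      (2 * rankSpread y - ((m + 1 : ℕ) : ℝ) * rankVariation y (Tuple.sort y))) := by
  have h1 := rankSpread_pos hm y hy
  rw [xiNormalized, xiSelf, xiN_eq_div hm y hy, xiN_eq_div hm y hy,
    div_div_div_cancel_right₀ (by positivity)]

/-- Everything follows from `0 < xiSelf y ≤ 1` and `xiN y σ ≤ xiSelf y`: dividing by a number in
`(0, 1]` keeps the sign and does not decrease nonnegative values, and truncation at `-1` affects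
only negative ones. -/
theorem xiNormalized_properties {n : ℕ} (hn : 2 < n) (y : Fin n → ℝ) (hy : NotAllEqual y)
    (σ : Equiv.Perm (Fin n)) :
    |xiNormalized y σ| ≤ 1 ∧
      SignType.sign (xiNormalized y σ) = SignType.sign (xiN y σ) ∧
      (0 ≤ xiN y σ → xiN y σ ≤ xiNormalized y σ) := by
  obtain ⟨m, rfl⟩ : ∃ m, n = m + 1 := ⟨n - 1, by omega⟩
  have hpos := xiSelf_pos hn y hy
  have hle1 := xiSelf_le_one hn y hy
  have hle := xiN_le_xiSelf hn y hy σ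
  unfold xiNormalized
  refine ⟨?_, ?_, fun h => ?_⟩
  · rw [abs_le]
    exact ⟨le_max_left _ _, max_le (by norm_num) ((div_le_one hpos).2 hle)⟩
  · rcases lt_trichotomy (xiN y σ) 0 with h | h | h
    · rw [sign_neg h, sign_neg (max_lt (by norm_num) (div_neg_of_neg_of_pos h hpos))]
    · rw [h, zero_div, max_eq_right (by norm_num)]
    · rw [sign_pos h, sign_pos (lt_max_of_lt_right (div_pos h hpos))]
  · exact le_max_of_le_right ((le_div_iff₀ hpos).2 (mul_le_of_le_one_right h hle1))

/-! ### Independence, orthogonality and second moments. -/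

theorem integrable_of_abs_le {Ω : Type*} [MeasurableSpace Ω] {P : Measure Ω} [IsFiniteMeasure P]
    {f : Ω → ℝ} (hf : Measurable f) {C : ℝ} (hC : ∀ ω, |f ω| ≤ C) : Integrable f P :=
  Integrable.of_bound hf.aestronglyMeasurable C (ae_of_all _ hC)

/-- Fubini in one coordinate of an independent family. -/
theorem integral_eq_zero_of_forall_integral_update {Ω α ι : Type*} [MeasurableSpace Ω]
    [MeasurableSpace α] [Fintype ι] [DecidableEq ι] {P : Measure Ω} [IsProbabilityMeasure P]
    {z : ι → Ω → α} (hz : ∀ i, Measurable (z i)) (hind : iIndepFun z P) (k : ι)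
    {f : (ι → α) → ℝ} (hf : Measurable f) {C : ℝ} (hC : ∀ v, |f v| ≤ C)
    (h : ∀ v, ∫ s, f (Function.update v k s) ∂(P.map (z k)) = 0) :
    ∫ ω, f (fun i => z i ω) ∂P = 0 := by
  classical
  obtain ⟨ω₀⟩ : Nonempty Ω := nonempty_of_isProbabilityMeasure P
  set a₀ : α := z k ω₀
  -- The `k`-th coordinate is filled with the constant `a₀`, so that the other coordinates become a
  -- full vector that is independent of `z k`.
  let e : (({i // i ∈ Finset.univ.erase k} : Type _) → α) → ι → α := fun u i =>
    if hi : i ∈ Finset.univ.erase k then u ⟨i, hi⟩ else a₀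
  have he : Measurable e := by
    refine measurable_pi_lambda _ fun i => ?_
    by_cases hi : i ∈ Finset.univ.erase k
    · simpa only [e, hi, dif_pos] using measurable_pi_apply _
    · simpa only [e, hi, dif_neg, not_false_iff] using measurable_const
  have h1 := hind.indepFun_finset {k} (Finset.univ.erase k) (by simp) hz
  have h2 : IndepFun (z k) (fun ω => e fun i => z i ω) P :=
    h1.comp (φ := fun u : ({i // i ∈ ({k} : Finset ι)} → α) => u ⟨k, by simp⟩)
      (measurable_pi_apply _) he
  have hem : Measurable fun ω => e fun i => z i ω :=
    he.comp (measurable_pi_lambda _ fun i => hz i)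
  have h3 := (indepFun_iff_map_prod_eq_prod_map_map (hz k).aemeasurable hem.aemeasurable).1 h2
  have hupd : ∀ ω, (fun i => z i ω) = Function.update (e fun i => z i ω) k (z k ω) := by
    intro ω
    ext i
    by_cases hi : i = k
    · subst hi; simp
    · simp [e, hi]
  let F : α × (ι → α) → ℝ := fun p => f (Function.update p.2 k p.1)
  have hF : Measurable F := by
    refine hf.comp (measurable_pi_lambda _ fun i => ?_)
    by_cases hi : i = k
    · subst hi; simpa using measurable_fst
    · simp only [Function.update_of_ne hi]
      exact (measurable_pi_apply i).comp measurable_snd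
  have := Measure.isProbabilityMeasure_map (μ := P) (hz k).aemeasurable
  have := Measure.isProbabilityMeasure_map (μ := P) hem.aemeasurable
  calc ∫ ω, f (fun i => z i ω) ∂P = ∫ ω, F (z k ω, e fun i => z i ω) ∂P := by
        refine integral_congr_ae (ae_of_all _ fun ω => ?_)
        exact congrArg f (hupd ω)
    _ = ∫ p, F p ∂(P.map fun ω => (z k ω, e fun i => z i ω)) :=
        (integral_map ((hz k).prodMk hem).aemeasurable hF.aestronglyMeasurable).symm
    _ = 0 := by
        rw [h3, integral_prod_symm _ (integrable_of_abs_le hF fun p => hC _)]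
        simp [F, h]

theorem integral_abs_sum_le_sqrt {Ω ι : Type*} [MeasurableSpace Ω] {P : Measure Ω}
    [IsProbabilityMeasure P] (s : Finset ι) {a : ι → Ω → ℝ} (ha : ∀ i, Measurable (a i))
    (hb : ∀ i ω, |a i ω| ≤ 1)
    (horth : ∀ i ∈ s, ∀ j ∈ s, i ≠ j → ∫ ω, a i ω * a j ω ∂P = 0) :
    ∫ ω, |∑ i ∈ s, a i ω| ∂P ≤ √(s.card) := by
  classical
  rcases s.eq_empty_or_nonempty with rfl | hs
  · simp
  have hprod : ∀ i j, Integrable (fun ω => a i ω * a j ω) P := fun i j =>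
    integrable_of_abs_le ((ha i).mul (ha j)) (C := 1) fun ω => by
      rw [abs_mul]
      exact mul_le_one₀ (hb i ω) (abs_nonneg _) (hb j ω)
  have hint : ∀ i, Integrable (a i) P := fun i => integrable_of_abs_le (ha i) (hb i)
  have hsq : ∫ ω, (∑ i ∈ s, a i ω) ^ 2 ∂P ≤ s.card := by
    have : ∀ ω, (∑ i ∈ s, a i ω) ^ 2 = ∑ i ∈ s, ∑ j ∈ s, a i ω * a j ω := fun ω => by
      rw [sq, Finset.sum_mul_sum]
    simp_rw [this]
    rw [integral_finsetSum _ fun i _ => integrable_finsetSum _ fun j _ => hprod i j]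
    simp_rw [integral_finsetSum _ fun j _ => hprod _ j]
    calc ∑ i ∈ s, ∑ j ∈ s, ∫ ω, a i ω * a j ω ∂P = ∑ i ∈ s, ∫ ω, a i ω * a i ω ∂P := by
          refine Finset.sum_congr rfl fun i hi => ?_
          refine Finset.sum_eq_single i (fun j hj hne => horth i hi j hj hne.symm) fun h => ?_
          exact absurd hi h
      _ ≤ ∑ i ∈ s, 1 := by
          refine Finset.sum_le_sum fun i _ => ?_
          have : ∫ ω, a i ω * a i ω ∂P ≤ ∫ _, (1 : ℝ) ∂P := by
            refine integral_mono (hprod i i) (integrable_const _) fun ω => ?_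
            have := abs_le.1 (hb i ω)
            simp only
            nlinarith
          simpa using this
      _ = s.card := by simp
  have hsint : Integrable (fun ω => (∑ i ∈ s, a i ω) ^ 2) P := by
    have : ∀ ω, (∑ i ∈ s, a i ω) ^ 2 = ∑ i ∈ s, ∑ j ∈ s, a i ω * a j ω := fun ω => by
      rw [sq, Finset.sum_mul_sum]
    simp_rw [this]
    exact integrable_finsetSum _ fun i _ => integrable_finsetSum _ fun j _ => hprod i j
  have hK : 0 < √(s.card : ℝ) := Real.sqrt_pos.2 (by exact_mod_cast hs.card_pos)
  set K := √(s.card : ℝ)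
  have hK2 : K ^ 2 = s.card := Real.sq_sqrt (Nat.cast_nonneg _)
  -- The inequality `t ≤ t² / (2K) + K / 2` with `K = √|s|` takes the place of Cauchy–Schwarz.
  calc ∫ ω, |∑ i ∈ s, a i ω| ∂P ≤ ∫ ω, ((∑ i ∈ s, a i ω) ^ 2 / (2 * K) + K / 2) ∂P := by
        refine integral_mono (integrable_finsetSum s fun i _ => hint i).abs
          ((hsint.div_const _).add (integrable_const _)) fun ω => ?_
        simp only
        rw [← sq_abs]
        generalize |∑ i ∈ s, a i ω| = t
        rw [div_add_div _ _ (by positivity) two_ne_zero, le_div_iff₀ (by positivity)]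
        nlinarith [sq_nonneg (t - K)]
    _ = (∫ ω, (∑ i ∈ s, a i ω) ^ 2 ∂P) / (2 * K) + K / 2 := by
        rw [integral_add (hsint.div_const _) (integrable_const _), integral_div]
        simp
    _ ≤ K ^ 2 / (2 * K) + K / 2 := by rw [hK2]; gcongr
    _ = K := by field_simp; ring

/-! ### Uniform tie breaking. -/

/-- The weights of the orderings under uniform tie breaking. -/
noncomputable def tieWeight {n : ℕ} (π : Equiv.Perm (Fin n)) (x : Fin n → ℝ) : ℝ :=
  open Classical in
  if IsOrdering x π then (({τ : Equiv.Perm (Fin n) | IsOrdering x τ}.ncard : ℝ))⁻¹ else 0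

theorem measurableSet_isOrdering {n : ℕ} (π : Equiv.Perm (Fin n)) :
    MeasurableSet {x : Fin n → ℝ | IsOrdering x π} := by
  have : {x : Fin n → ℝ | IsOrdering x π} =
      ⋂ i, ⋂ j, ⋂ (_ : i ≤ j), {x : Fin n → ℝ | x (π i) ≤ x (π j)} := by
    ext x
    simp [IsOrdering, Monotone]
  rw [this]
  refine MeasurableSet.iInter fun i => MeasurableSet.iInter fun j => MeasurableSet.iInter fun _ => ?_
  exact measurableSet_le (measurable_pi_apply _) (measurable_pi_apply _)

theorem measurable_tieWeight {n : ℕ} (π : Equiv.Perm (Fin n)) : Measurable (tieWeight π) := by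
  classical
  have hcount : ∀ x : Fin n → ℝ, ({τ : Equiv.Perm (Fin n) | IsOrdering x τ}.ncard : ℝ) =
      ∑ τ : Equiv.Perm (Fin n), if IsOrdering x τ then (1 : ℝ) else 0 := fun x => by
    rw [Set.ncard_eq_toFinset_card', Finset.sum_boole]
    congr 2
    ext j
    simp
  refine Measurable.ite (measurableSet_isOrdering π) (Measurable.inv ?_) measurable_const
  simp_rw [hcount]
  exact Finset.measurable_sum _ fun τ _ =>
    Measurable.ite (measurableSet_isOrdering τ) measurable_const measurable_const

theorem abs_tieWeight_le {n : ℕ} (π : Equiv.Perm (Fin n)) (x : Fin n → ℝ) :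
    |tieWeight π x| ≤ 1 := by
  unfold tieWeight
  split_ifs with h
  · rw [abs_of_nonneg (inv_nonneg.2 (Nat.cast_nonneg _))]
    refine inv_le_one_of_one_le₀ ?_
    exact_mod_cast (Set.ncard_pos (Set.toFinite _)).2 ⟨π, h⟩
  · simp

/-- Conditioning on the data and pulling out the data-measurable factor replaces the event `σ = π`
by a weight that is a function of `x` alone. This is how the uniformity of the tie breaking enters
the proof. -/
theorem integral_indicator_tieBreaking_mul {Ω : Type*} [MeasurableSpace Ω] {P : Measure Ω}
    [IsProbabilityMeasure P] {n : ℕ} {z : Fin n → Ω → ℝ × ℝ} (hz : ∀ i, Measurable (z i))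
    {σ : Ω → Equiv.Perm (Fin n)}
    (hσ : IsUniformTieBreaking P (fun ω i => (z i ω).1) (fun ω i => (z i ω).2) σ)
    (π : Equiv.Perm (Fin n)) {g : (Fin n → ℝ × ℝ) → ℝ} (hg : Measurable g) {C : ℝ}
    (hC : ∀ v, |g v| ≤ C) :
    ∫ ω, Set.indicator {ω | σ ω = π} (fun _ => (1 : ℝ)) ω * g (fun i => z i ω) ∂P =
      ∫ ω, tieWeight π (fun i => (z i ω).1) * g (fun i => z i ω) ∂P := by
  obtain ⟨hmeas, hcond⟩ := hσ π
  set D : Ω → (Fin n → ℝ) × (Fin n → ℝ) := fun ω => (fun i => (z i ω).1, fun i => (z i ω).2) with hD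
  have hDm : Measurable D := by fun_prop
  have hm : MeasurableSpace.comap D inferInstance ≤ ‹MeasurableSpace Ω› := hDm.comap_le
  let g' : (Fin n → ℝ) × (Fin n → ℝ) → ℝ := fun p => g fun i => (p.1 i, p.2 i)
  have hg' : Measurable g' := hg.comp (by fun_prop)
  have hgD : (fun ω => g (fun i => z i ω)) = g' ∘ D := rfl
  have hsm : StronglyMeasurable[MeasurableSpace.comap D inferInstance] (g' ∘ D) :=
    (hg'.comp (comap_measurable D)).stronglyMeasurable
  set ind : Ω → ℝ := Set.indicator {ω | σ ω = π} (fun _ => (1 : ℝ)) with hind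
  have hindm : Measurable ind := measurable_const.indicator hmeas
  have hind1 : ∀ ω, |ind ω| ≤ 1 := fun ω => by
    simp only [hind, Set.indicator]
    split_ifs <;> simp
  have hindi : Integrable ind P := integrable_of_abs_le hindm hind1
  have hprod : Integrable (ind * (g' ∘ D)) P :=
    integrable_of_abs_le (hindm.mul (hg'.comp hDm)) (C := C) fun ω => by
      rw [Pi.mul_apply, abs_mul]
      refine (mul_le_of_le_one_left (abs_nonneg _) (hind1 ω)).trans (hC _)
  have h1 := condExp_mul_of_stronglyMeasurable_right hsm hprod hindi
  calc ∫ ω, ind ω * g (fun i => z i ω) ∂P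
      = ∫ ω, (P[ind * (g' ∘ D) | MeasurableSpace.comap D inferInstance]) ω ∂P :=
        (integral_condExp hm).symm
    _ = ∫ ω, tieWeight π (fun i => (z i ω).1) * g (fun i => z i ω) ∂P := by
        refine integral_congr_ae ?_
        filter_upwards [h1, hcond] with ω h2 h3
        rw [h2, Pi.mul_apply]
        rw [h3]
        rfl

theorem sum_indicator_perm_eq {Ω : Type*} {n : ℕ} (σ : Ω → Equiv.Perm (Fin n))
    (F : Equiv.Perm (Fin n) → Ω → ℝ) (ω : Ω) :
    F (σ ω) ω = ∑ π, Set.indicator {ω | σ ω = π} (fun _ => (1 : ℝ)) ω * F π ω := by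
  classical
  simp [Set.indicator]

theorem measurable_perm_apply {Ω : Type*} [MeasurableSpace Ω] {n : ℕ}
    {σ : Ω → Equiv.Perm (Fin n)} (hσ : ∀ π, MeasurableSet {ω | σ ω = π})
    {F : Equiv.Perm (Fin n) → Ω → ℝ} (hF : ∀ π, Measurable (F π)) :
    Measurable fun ω => F (σ ω) ω := by
  simp_rw [fun ω => sum_indicator_perm_eq σ F ω]
  exact Finset.measurable_sum _ fun π _ => (measurable_const.indicator (hσ π)).mul (hF π)

/-- Under uniform tie breaking, a noise term whose conditional mean given `x` vanishes is
orthogonal to everything that depends on its own observation only through `x`. -/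
theorem integral_mul_noise_eq_zero {Ω : Type*} [MeasurableSpace Ω] {P : Measure Ω}
    [IsProbabilityMeasure P] {n : ℕ} {z : Fin n → Ω → ℝ × ℝ} (hz : ∀ i, Measurable (z i))
    (hind : iIndepFun z P) {ρ : Measure (ℝ × ℝ)} (hρ : ∀ i, P.map (z i) = ρ)
    {σ : Ω → Equiv.Perm (Fin n)}
    (hσ : IsUniformTieBreaking P (fun ω i => (z i ω).1) (fun ω i => (z i ω).2) σ)
    {ε : ℝ × ℝ → ℝ} (hε : Measurable ε) (hε1 : ∀ s, |ε s| ≤ 1)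
    (hε0 : ∀ ψ : ℝ → ℝ, Measurable ψ → (∃ C, ∀ x, |ψ x| ≤ C) → ∫ s, ψ s.1 * ε s ∂ρ = 0)
    (k : Fin n) {Ψ : (Fin n → ℝ × ℝ) → ℝ} (hΨ : Measurable Ψ) (hΨ1 : ∀ v, |Ψ v| ≤ 1)
    (hdep : ∀ v x y y', Ψ (Function.update v k (x, y)) = Ψ (Function.update v k (x, y'))) :
    ∫ ω, Ψ (fun i => z (σ ω i) ω) * ε (z (σ ω k) ω) ∂P = 0 := by
  have hZ : ∀ π : Equiv.Perm (Fin n), Measurable fun v : Fin n → ℝ × ℝ =>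
      Ψ (fun i => v (π i)) * ε (v (π k)) := fun π =>
    (hΨ.comp (by fun_prop)).mul (hε.comp (measurable_pi_apply _))
  have hZ1 : ∀ (π : Equiv.Perm (Fin n)) (v : Fin n → ℝ × ℝ),
      |Ψ (fun i => v (π i)) * ε (v (π k))| ≤ 1 := fun π v => by
    rw [abs_mul]
    exact mul_le_one₀ (hΨ1 _) (abs_nonneg _) (hε1 _)
  have hzm : Measurable fun ω i => z i ω := measurable_pi_lambda _ hz
  have hsum : ∀ ω, Ψ (fun i => z (σ ω i) ω) * ε (z (σ ω k) ω) =
      ∑ π, Set.indicator {ω | σ ω = π} (fun _ => (1 : ℝ)) ω *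
        (Ψ (fun i => z (π i) ω) * ε (z (π k) ω)) := fun ω =>
    sum_indicator_perm_eq σ (fun π ω => Ψ (fun i => z (π i) ω) * ε (z (π k) ω)) ω
  simp_rw [hsum]
  rw [integral_finsetSum]
  · refine Finset.sum_eq_zero fun π _ => ?_
    rw [integral_indicator_tieBreaking_mul hz hσ π (hZ π) (hZ1 π)]
    have hxm : Measurable fun v : Fin n → ℝ × ℝ => fun i => (v i).1 := by fun_prop
    -- For a fixed permutation, only the observation with index `π k` is integrated, all others
    -- being frozen.
    refine integral_eq_zero_of_forall_integral_update hz hind (π k)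
      (f := fun v => tieWeight π (fun i => (v i).1) * (Ψ (fun i => v (π i)) * ε (v (π k))))
      (((measurable_tieWeight π).comp hxm).mul (hZ π)) (C := 1) (fun v => ?_) fun v => ?_
    · rw [abs_mul]
      exact mul_le_one₀ (abs_tieWeight_le _ _) (abs_nonneg _) (hZ1 π v)
    · have hcomp : ∀ s : ℝ × ℝ, (fun i => Function.update v (π k) s (π i)) =
          Function.update (fun i => v (π i)) k s := fun s => by
        ext1 i
        by_cases hi : i = k
        · subst hi; simp
        · simp [Function.update_of_ne hi, Function.update_of_ne (π.injective.ne hi)]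
      have hfst : ∀ s : ℝ × ℝ, (fun i => (Function.update v (π k) s i).1) =
          Function.update (fun i => (v i).1) (π k) s.1 := fun s => by
        ext1 i
        by_cases hi : i = π k
        · subst hi; simp
        · simp [Function.update_of_ne hi]
      -- `ψ` collects the factors that see this observation only through its `x`-coordinate; by
      -- `hdep` the missing `y`-coordinate may be set to 0.
      let ψ : ℝ → ℝ := fun x => tieWeight π (Function.update (fun i => (v i).1) (π k) x) *
        Ψ (Function.update (fun i => v (π i)) k (x, 0))
      have hψ : Measurable ψ :=
        ((measurable_tieWeight π).comp (measurable_update _)).mul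
          (hΨ.comp ((measurable_update _).comp (measurable_id.prodMk measurable_const)))
      rw [hρ]
      refine (integral_congr_ae (ae_of_all _ fun s => ?_)).trans (hε0 ψ hψ ⟨1, fun x => ?_⟩)
      · simp only [hcomp, hfst, Function.update_self, ψ]
        rw [hdep _ s.1 0 s.2]
        ring
      · rw [abs_mul]
        exact mul_le_one₀ (abs_tieWeight_le _ _) (abs_nonneg _) (hΨ1 _)
  · intro π _
    refine integrable_of_abs_le ((measurable_const.indicator (hσ π).1).mul ((hZ π).comp hzm))
      (C := 1) fun ω => ?_
    rw [abs_mul]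
    refine mul_le_one₀ ?_ (abs_nonneg _) (hZ1 π fun i => z i ω)
    simp only [Set.indicator]
    split_ifs <;> simp

theorem measurable_sorted {Ω : Type*} [MeasurableSpace Ω] {n : ℕ} {z : Fin n → Ω → ℝ × ℝ}
    (hz : ∀ i, Measurable (z i)) {σ : Ω → Equiv.Perm (Fin n)}
    (hσ : ∀ π, MeasurableSet {ω | σ ω = π}) : Measurable fun ω i => z (σ ω i) ω := by
  refine measurable_pi_lambda _ fun i => Measurable.prodMk ?_ ?_
  · exact measurable_perm_apply hσ (F := fun π ω => (z (π i) ω).1) fun π => (hz _).fst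
  · exact measurable_perm_apply hσ (F := fun π ω => (z (π i) ω).2) fun π => (hz _).snd

/-- The weight of `π` vanishes wherever `π` fails to sort `x`. Testing the tie-breaking law against
the indicator `g` of this failure shows that it almost surely does not occur together with `σ = π`.
-/
theorem ae_isOrdering {Ω : Type*} [MeasurableSpace Ω] {P : Measure Ω}
    [IsProbabilityMeasure P] {n : ℕ} {z : Fin n → Ω → ℝ × ℝ} (hz : ∀ i, Measurable (z i))
    {σ : Ω → Equiv.Perm (Fin n)}
    (hσ : IsUniformTieBreaking P (fun ω i => (z i ω).1) (fun ω i => (z i ω).2) σ) :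
    ∀ᵐ ω ∂P, IsOrdering (fun i => (z i ω).1) (σ ω) := by
  classical
  have key : ∀ π : Equiv.Perm (Fin n),
      ∀ᵐ ω ∂P, σ ω = π → IsOrdering (fun i => (z i ω).1) π := by
    intro π
    set g : (Fin n → ℝ × ℝ) → ℝ := fun v => if IsOrdering (fun i => (v i).1) π then 0 else 1
    have hxm : Measurable fun v : Fin n → ℝ × ℝ => fun i => (v i).1 := by fun_prop
    have hg : Measurable g := Measurable.ite (hxm (measurableSet_isOrdering π)) measurable_const
      measurable_const
    have hg1 : ∀ v, |g v| ≤ 1 := fun v => by simp only [g]; split_ifs <;> simp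
    have hzm : Measurable fun ω i => z i ω := measurable_pi_lambda _ hz
    have h1 := integral_indicator_tieBreaking_mul hz hσ π hg hg1
    have h2 : ∀ ω, tieWeight π (fun i => (z i ω).1) * g (fun i => z i ω) = 0 := fun ω => by
      simp only [tieWeight, g]
      split_ifs <;> simp
    simp_rw [h2] at h1
    rw [integral_zero, integral_eq_zero_iff_of_nonneg] at h1
    · filter_upwards [h1] with ω hω hπ
      by_contra hno
      simp [Set.indicator, hπ, g, hno] at hω
    · intro ω
      simp only [Set.indicator, g]
      split_ifs <;> simp
    · refine integrable_of_abs_le ((measurable_const.indicator (hσ π).1).mul (hg.comp hzm))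
        (C := 1) fun ω => ?_
      simp only [Set.indicator, g]
      split_ifs <;> simp
  filter_upwards [ae_all_iff.2 key] with ω hω
  exact hω _ rfl

/-! ### `L¹` bounds for sums along the sorted sample. -/

/-- A quantitative law of large numbers in `L¹`. -/
theorem integral_abs_sum_sub_integral_le {Ω α : Type*} [MeasurableSpace Ω] [MeasurableSpace α]
    {P : Measure Ω} [IsProbabilityMeasure P] {n : ℕ} {z : Fin n → Ω → α}
    (hz : ∀ i, Measurable (z i)) (hind : iIndepFun z P) {ρ : Measure α} [IsProbabilityMeasure ρ]
    (hρ : ∀ i, P.map (z i) = ρ) {f : α → ℝ} (hf : Measurable f)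
    (hf0 : ∀ s, f s ∈ Set.Icc (0 : ℝ) 1) :
    ∫ ω, |∑ i, (f (z i ω) - ∫ s, f s ∂ρ)| ∂P ≤ √n := by
  have hfi : Integrable f ρ := integrable_of_abs_le hf (C := 1) fun s =>
    abs_le.2 ⟨by linarith [(hf0 s).1], (hf0 s).2⟩
  set c := ∫ s, f s ∂ρ with hc
  have hc0 : 0 ≤ c := integral_nonneg fun s => (hf0 s).1
  have hc1 : c ≤ 1 := by
    have := integral_mono hfi (integrable_const (1 : ℝ)) fun s => (hf0 s).2
    simpa using this
  have hb : ∀ s, |f s - c| ≤ 1 := fun s =>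
    abs_le.2 ⟨by linarith [(hf0 s).1], by linarith [(hf0 s).2]⟩
  have h0 : ∫ s, (f s - c) ∂ρ = 0 := by
    rw [integral_sub hfi (integrable_const _)]
    simp [hc]
  have := integral_abs_sum_le_sqrt (P := P) Finset.univ (a := fun i ω => f (z i ω) - c)
    (fun i => (hf.comp (hz i)).sub_const c) (fun i ω => hb _) fun i _ j _ hij => by
      refine integral_eq_zero_of_forall_integral_update hz hind i
        (f := fun v => (f (v i) - c) * (f (v j) - c)) ?_ (C := 1) (fun v => ?_) fun v => ?_
      · exact ((hf.comp (measurable_pi_apply i)).sub_const c).mul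
          ((hf.comp (measurable_pi_apply j)).sub_const c)
      · rw [abs_mul]
        exact mul_le_one₀ (hb _) (abs_nonneg _) (hb _)
      · simp only [Function.update_self, Function.update_of_ne hij.symm]
        rw [hρ, integral_mul_const, h0, zero_mul]
  simpa using this

section Noise

variable {Ω : Type*} [MeasurableSpace Ω] {P : Measure Ω} [IsProbabilityMeasure P] {m : ℕ}
  {z : Fin (m + 1) → Ω → ℝ × ℝ} {ρ : Measure (ℝ × ℝ)}
  {σ : Ω → Equiv.Perm (Fin (m + 1))} {φ h : ℝ → ℝ}

theorem abs_mul_mul_le_one {a b c : ℝ} (ha : |a| ≤ 1) (hb : |b| ≤ 1) (hc : |c| ≤ 1) :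
    |a * b * c| ≤ 1 := by
  rw [abs_mul, abs_mul]
  exact mul_le_one₀ (mul_le_one₀ ha (abs_nonneg _) hb) (abs_nonneg _) hc

theorem abs_le_one_of_mem {a : ℝ} (ha : a ∈ Set.Icc (0 : ℝ) 1) : |a| ≤ 1 :=
  abs_le.2 ⟨by linarith [ha.1], ha.2⟩

theorem abs_sub_le_one_of_mem {a b : ℝ} (ha : a ∈ Set.Icc (0 : ℝ) 1)
    (hb : b ∈ Set.Icc (0 : ℝ) 1) : |a - b| ≤ 1 :=
  abs_le.2 ⟨by linarith [ha.1, hb.2], by linarith [ha.2, hb.1]⟩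

/-- With the noise `ε = φ y - h x`, one has `φ φ' - h h' = ε φ' + h ε'`, where primes denote the
next observation in the order. Each of the two families of summands is orthogonal and contributes
`√m`. -/
theorem integral_abs_sum_mul_sub_mul_le (hz : ∀ i, Measurable (z i)) (hind : iIndepFun z P)
    (hρ : ∀ i, P.map (z i) = ρ)
    (hσ : IsUniformTieBreaking P (fun ω i => (z i ω).1) (fun ω i => (z i ω).2) σ)
    (hφ : Measurable φ) (hφ1 : ∀ y, φ y ∈ Set.Icc (0 : ℝ) 1)
    (hh : Measurable h) (hh1 : ∀ x, h x ∈ Set.Icc (0 : ℝ) 1)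
    (hε0 : ∀ ψ : ℝ → ℝ, Measurable ψ → (∃ C, ∀ x, |ψ x| ≤ C) →
      ∫ s, ψ s.1 * (φ s.2 - h s.1) ∂ρ = 0) :
    ∫ ω, |∑ i : Fin m, (φ (z (σ ω i.castSucc) ω).2 * φ (z (σ ω i.succ) ω).2 -
      h (z (σ ω i.castSucc) ω).1 * h (z (σ ω i.succ) ω).1)| ∂P ≤ 2 * √m := by
  set ε : ℝ × ℝ → ℝ := fun s => φ s.2 - h s.1 with hεdef
  have hε : Measurable ε := (hφ.comp measurable_snd).sub (hh.comp measurable_fst)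
  have hε1 : ∀ s, |ε s| ≤ 1 := fun s => abs_sub_le_one_of_mem (hφ1 _) (hh1 _)
  have hφa := fun y => abs_le_one_of_mem (hφ1 y)
  have hha := fun y => abs_le_one_of_mem (hh1 y)
  have hZ := measurable_sorted hz fun π => (hσ π).1
  have hZi : ∀ i, Measurable fun ω => z (σ ω i) ω := fun i => (measurable_pi_apply i).comp hZ
  set a : Fin m → Ω → ℝ := fun i ω => ε (z (σ ω i.castSucc) ω) * φ (z (σ ω i.succ) ω).2
    with ha
  set b : Fin m → Ω → ℝ := fun i ω => h (z (σ ω i.castSucc) ω).1 * ε (z (σ ω i.succ) ω)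
    with hb
  have ham : ∀ i, Measurable (a i) := fun i => (hε.comp (hZi _)).mul (hφ.comp (hZi _).snd)
  have hbm : ∀ i, Measurable (b i) := fun i => (hh.comp (hZi _).fst).mul (hε.comp (hZi _))
  have ha1 : ∀ i ω, |a i ω| ≤ 1 := fun i ω => by
    rw [ha, abs_mul]; exact mul_le_one₀ (hε1 _) (abs_nonneg _) (hφa _)
  have hb1 : ∀ i ω, |b i ω| ≤ 1 := fun i ω => by
    rw [hb, abs_mul]; exact mul_le_one₀ (hha _) (abs_nonneg _) (hε1 _)
  -- The earliest position `i.castSucc` occurs only in its own noise factor. The later positions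
  -- `i.succ` and `j.castSucc` may coincide.
  have haorth : ∀ i j : Fin m, i < j → ∫ ω, a i ω * a j ω ∂P = 0 := by
    intro i j hij
    have n1 : i.succ ≠ i.castSucc := by simp [Fin.ext_iff]
    have n2 : j.castSucc ≠ i.castSucc := fun h => hij.ne (Fin.castSucc_injective m h).symm
    have n3 : j.succ ≠ i.castSucc := by
      have : (i : ℕ) < j := hij
      simp only [ne_eq, Fin.ext_iff, Fin.val_succ, Fin.val_castSucc]
      omega
    rw [← integral_mul_noise_eq_zero hz hind hρ hσ hε hε1 hε0 i.castSucc
      (Ψ := fun v => φ (v i.succ).2 * ε (v j.castSucc) * φ (v j.succ).2)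
      (((hφ.comp (measurable_pi_apply _).snd).mul (hε.comp (measurable_pi_apply _))).mul
        (hφ.comp (measurable_pi_apply _).snd))
      (fun v => abs_mul_mul_le_one (hφa _) (hε1 _) (hφa _))
      (fun v x y y' => by simp only [Function.update_of_ne n1, Function.update_of_ne n2,
        Function.update_of_ne n3])]
    refine integral_congr_ae (ae_of_all _ fun ω => ?_)
    simp only [ha]
    ring
  -- Here the noise stands on the right of each pair, so the isolated position is the last one,
  -- `j.succ`.
  have hborth : ∀ i j : Fin m, i < j → ∫ ω, b i ω * b j ω ∂P = 0 := by
    intro i j hij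
    have hij' : (i : ℕ) < j := hij
    have n1 : i.castSucc ≠ j.succ := by
      simp only [ne_eq, Fin.ext_iff, Fin.val_succ, Fin.val_castSucc]; omega
    have n2 : i.succ ≠ j.succ := by
      simp only [ne_eq, Fin.ext_iff, Fin.val_succ]; omega
    have n3 : j.castSucc ≠ j.succ := by simp [Fin.ext_iff]
    rw [← integral_mul_noise_eq_zero hz hind hρ hσ hε hε1 hε0 j.succ
      (Ψ := fun v => h (v i.castSucc).1 * ε (v i.succ) * h (v j.castSucc).1)
      (((hh.comp (measurable_pi_apply _).fst).mul (hε.comp (measurable_pi_apply _))).mul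
        (hh.comp (measurable_pi_apply _).fst))
      (fun v => abs_mul_mul_le_one (hha _) (hε1 _) (hha _))
      (fun v x y y' => by simp only [Function.update_of_ne n1, Function.update_of_ne n2,
        Function.update_of_ne n3])]
    refine integral_congr_ae (ae_of_all _ fun ω => ?_)
    simp only [hb]
    ring
  have symm : ∀ c : Fin m → Ω → ℝ, (∀ i j : Fin m, i < j → ∫ ω, c i ω * c j ω ∂P = 0) →
      ∀ i ∈ Finset.univ, ∀ j ∈ Finset.univ, i ≠ j → ∫ ω, c i ω * c j ω ∂P = 0 := by
    intro c hc i _ j _ hij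
    rcases lt_or_gt_of_ne hij with hlt | hlt
    · exact hc i j hlt
    · simp_rw [mul_comm (c i _)]
      exact hc j i hlt
  have hA := integral_abs_sum_le_sqrt Finset.univ ham ha1 (symm a haorth)
  have hB := integral_abs_sum_le_sqrt Finset.univ hbm hb1 (symm b hborth)
  rw [Finset.card_univ, Fintype.card_fin] at hA hB
  have hai : Integrable (fun ω => |∑ i, a i ω|) P :=
    (integrable_finsetSum _ fun i _ => integrable_of_abs_le (ham i) (ha1 i)).abs
  have hbi : Integrable (fun ω => |∑ i, b i ω|) P :=
    (integrable_finsetSum _ fun i _ => integrable_of_abs_le (hbm i) (hb1 i)).abs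
  calc _ ≤ ∫ ω, (|∑ i, a i ω| + |∑ i, b i ω|) ∂P := by
        refine integral_mono_of_nonneg (ae_of_all _ fun _ => abs_nonneg _) (hai.add hbi)
          (ae_of_all _ fun ω => ?_)
        simp only
        have : ∑ i : Fin m, (φ (z (σ ω i.castSucc) ω).2 * φ (z (σ ω i.succ) ω).2 -
            h (z (σ ω i.castSucc) ω).1 * h (z (σ ω i.succ) ω).1) =
            ∑ i, a i ω + ∑ i, b i ω := by
          rw [← Finset.sum_add_distrib]
          refine Finset.sum_congr rfl fun i _ => ?_
          simp only [ha, hb, hεdef]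
          ring
        rw [this]
        exact abs_add_le _ _
    _ ≤ 2 * √m := by
        rw [integral_add hai hbi]
        linarith

/-- Since `|h| ≤ 1`, each summand is at most an increment of `h` along the sorted `x`. Passing from
`h` to `g` costs the error `|h - g|` at both ends, and each observation belongs to at most two
increments, whence the factor 2. What remains is the variation of `g` along a monotone sequence. -/
theorem integral_abs_sum_mul_sub_sq_le (hz : ∀ i, Measurable (z i))
    (hρ : ∀ i, P.map (z i) = ρ)
    (hσ : IsUniformTieBreaking P (fun ω i => (z i ω).1) (fun ω i => (z i ω).2) σ)
    (hh1 : ∀ x, h x ∈ Set.Icc (0 : ℝ) 1) {g : ℝ → ℝ}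
    (hg : Integrable (fun s => h s.1 - g s.1) ρ) {K : ℝ}
    (hK : ∀ v : Fin (m + 1) → ℝ, Monotone v → ∑ i : Fin m, |g (v i.succ) - g (v i.castSucc)| ≤ K) :
    ∫ ω, |∑ i : Fin m, (h (z (σ ω i.castSucc) ω).1 * h (z (σ ω i.succ) ω).1 -
      h (z (σ ω i.castSucc) ω).1 ^ 2)| ∂P ≤ K + 2 * ((m + 1) * ∫ s, |h s.1 - g s.1| ∂ρ) := by
  set e : ℝ × ℝ → ℝ := fun s => |h s.1 - g s.1| with he
  have hei : ∀ i, Integrable (fun ω => e (z i ω)) P := fun i => by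
    have := hg.abs
    rw [← hρ i] at this
    exact this.comp_measurable (hz i)
  have heint : ∀ i, ∫ ω, e (z i ω) ∂P = ∫ s, e s ∂ρ := fun i => by
    have := hg.abs
    rw [← hρ i] at this ⊢
    exact (integral_map (hz i).aemeasurable this.aestronglyMeasurable).symm
  have hsum : Integrable (fun ω => K + 2 * ∑ i, e (z i ω)) P :=
    (integrable_const K).add ((integrable_finsetSum _ fun i _ => hei i).const_mul 2)
  calc _ ≤ ∫ ω, (K + 2 * ∑ i, e (z i ω)) ∂P := by
        refine integral_mono_of_nonneg (ae_of_all _ fun _ => abs_nonneg _) hsum ?_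
        filter_upwards [ae_isOrdering hz hσ] with ω hω
        have hsorted : ∑ i, e (z (σ ω i) ω) = ∑ i, e (z i ω) :=
          Equiv.sum_comp (σ ω) fun i => e (z i ω)
        have h1 := Fin.sum_univ_succ fun i => e (z (σ ω i) ω)
        have h2 := Fin.sum_univ_castSucc fun i => e (z (σ ω i) ω)
        have h3 : ∀ s, 0 ≤ e s := fun s => abs_nonneg _
        have h4 := h3 (z (σ ω 0) ω)
        have h5 := h3 (z (σ ω (Fin.last m)) ω)
        have h6 := hK (fun i => (z (σ ω i) ω).1) hω
        have h7 : ∑ i : Fin m, |h (z (σ ω i.castSucc) ω).1 * h (z (σ ω i.succ) ω).1 -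
            h (z (σ ω i.castSucc) ω).1 ^ 2| ≤
            ∑ i : Fin m, (e (z (σ ω i.succ) ω) + e (z (σ ω i.castSucc) ω) +
              |g (z (σ ω i.succ) ω).1 - g (z (σ ω i.castSucc) ω).1|) := by
          refine Finset.sum_le_sum fun i _ => ?_
          simp only [he]
          generalize (z (σ ω i.succ) ω).1 = u
          generalize (z (σ ω i.castSucc) ω).1 = v
          have hv := abs_le_one_of_mem (hh1 v)
          calc |h v * h u - h v ^ 2| = |h v| * |h u - h v| := by rw [← abs_mul]; ring_nf
            _ ≤ |h u - h v| := mul_le_of_le_one_left (abs_nonneg _) hv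
            _ = |(h u - g u) + (-(h v - g v)) + (g u - g v)| := by ring_nf
            _ ≤ |h u - g u| + |-(h v - g v)| + |g u - g v| := abs_add_three _ _ _
            _ = _ := by rw [abs_neg]
        rw [Finset.sum_add_distrib, Finset.sum_add_distrib] at h7
        refine (Finset.abs_sum_le_sum_abs _ _).trans ?_
        linarith
    _ = K + 2 * ((m + 1) * ∫ s, e s ∂ρ) := by
        rw [integral_add (integrable_const K)
          ((integrable_finsetSum _ fun i _ => hei i).const_mul 2), integral_const_mul,
          integral_finsetSum _ fun i _ => hei i]
        simp [heint]

theorem sum_sq_succ_sub (f : Fin (m + 1) → ℝ) :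
    ∑ i : Fin m, (f i.succ - f i.castSucc) ^ 2 =
      2 * ∑ i, f i ^ 2 - f 0 ^ 2 - f (Fin.last m) ^ 2 -
        2 * ∑ i : Fin m, f i.castSucc * f i.succ := by
  have h1 := Fin.sum_univ_succ fun i => f i ^ 2
  have h2 := Fin.sum_univ_castSucc fun i => f i ^ 2
  have h3 : ∑ i : Fin m, (f i.succ - f i.castSucc) ^ 2 =
      ∑ i : Fin m, f i.succ ^ 2 + ∑ i : Fin m, f i.castSucc ^ 2 -
        2 * ∑ i : Fin m, f i.castSucc * f i.succ := by
    rw [Finset.mul_sum, ← Finset.sum_add_distrib, ← Finset.sum_sub_distrib]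
    exact Finset.sum_congr rfl fun i _ => by ring
  linarith

/-- Expanding the squares leaves four errors, each counted twice: `A` replaces products of `φ` by
products of `h`, `B` replaces these by squares, `C` and `D` are laws of large numbers for `h²` and
`φ²`. The term `8 * √(m + 1)` collects `A`, `C` and `D`; the constant 4 absorbs the boundary terms.
-/
theorem integral_abs_sum_sq_sub_le [IsProbabilityMeasure ρ] (hz : ∀ i, Measurable (z i))
    (hind : iIndepFun z P) (hρ : ∀ i, P.map (z i) = ρ)
    (hσ : IsUniformTieBreaking P (fun ω i => (z i ω).1) (fun ω i => (z i ω).2) σ)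
    (hφ : Measurable φ) (hφ1 : ∀ y, φ y ∈ Set.Icc (0 : ℝ) 1)
    (hh : Measurable h) (hh1 : ∀ x, h x ∈ Set.Icc (0 : ℝ) 1)
    (hε0 : ∀ ψ : ℝ → ℝ, Measurable ψ → (∃ C, ∀ x, |ψ x| ≤ C) →
      ∫ s, ψ s.1 * (φ s.2 - h s.1) ∂ρ = 0)
    {g : ℝ → ℝ} (hg : Integrable (fun s => h s.1 - g s.1) ρ) {K : ℝ}
    (hK : ∀ v : Fin (m + 1) → ℝ, Monotone v →
      ∑ i : Fin m, |g (v i.succ) - g (v i.castSucc)| ≤ K) :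
    ∫ ω, |∑ i : Fin m, (φ (z (σ ω i.succ) ω).2 - φ (z (σ ω i.castSucc) ω).2) ^ 2 -
        (m + 1) * (2 * (∫ s, φ s.2 ^ 2 ∂ρ - ∫ s, h s.1 ^ 2 ∂ρ))| ∂P ≤
      8 * √(m + 1) + 4 + 2 * K + 4 * ((m + 1) * ∫ s, |h s.1 - g s.1| ∂ρ) := by
  have hZ := measurable_sorted hz fun π => (hσ π).1
  have hZi : ∀ i, Measurable fun ω => z (σ ω i) ω := fun i => (measurable_pi_apply i).comp hZ
  have hsq : ∀ {a : ℝ}, a ∈ Set.Icc (0 : ℝ) 1 → a ^ 2 ∈ Set.Icc (0 : ℝ) 1 := fun ha =>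
    ⟨by positivity, pow_le_one₀ ha.1 ha.2⟩
  have hmul : ∀ {a b : ℝ}, a ∈ Set.Icc (0 : ℝ) 1 → b ∈ Set.Icc (0 : ℝ) 1 →
      a * b ∈ Set.Icc (0 : ℝ) 1 := fun ha hb =>
    ⟨mul_nonneg ha.1 hb.1, mul_le_one₀ ha.2 hb.1 hb.2⟩
  have hA := integral_abs_sum_mul_sub_mul_le hz hind hρ hσ hφ hφ1 hh hh1 hε0
  have hB := integral_abs_sum_mul_sub_sq_le hz hρ hσ hh1 hg hK
  have hC := integral_abs_sum_sub_integral_le hz hind hρ (f := fun s => h s.1 ^ 2)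
    ((hh.comp measurable_fst).pow_const 2) fun s => hsq (hh1 _)
  have hD := integral_abs_sum_sub_integral_le hz hind hρ (f := fun s => φ s.2 ^ 2)
    ((hφ.comp measurable_snd).pow_const 2) fun s => hsq (hφ1 _)
  set A : Ω → ℝ := fun ω => ∑ i : Fin m,
    (φ (z (σ ω i.castSucc) ω).2 * φ (z (σ ω i.succ) ω).2 -
      h (z (σ ω i.castSucc) ω).1 * h (z (σ ω i.succ) ω).1) with hAdef
  set B : Ω → ℝ := fun ω => ∑ i : Fin m, (h (z (σ ω i.castSucc) ω).1 * h (z (σ ω i.succ) ω).1 -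
      h (z (σ ω i.castSucc) ω).1 ^ 2) with hBdef
  set C : Ω → ℝ := fun ω => ∑ i, (h (z i ω).1 ^ 2 - ∫ s, h s.1 ^ 2 ∂ρ) with hCdef
  set D : Ω → ℝ := fun ω => ∑ i, (φ (z i ω).2 ^ 2 - ∫ s, φ s.2 ^ 2 ∂ρ) with hDdef
  have hAi : Integrable A P := integrable_finsetSum _ fun i _ =>
    integrable_of_abs_le
      (((hφ.comp (hZi _).snd).mul (hφ.comp (hZi _).snd)).sub
        ((hh.comp (hZi _).fst).mul (hh.comp (hZi _).fst)))
      fun ω => abs_sub_le_one_of_mem (hmul (hφ1 _) (hφ1 _)) (hmul (hh1 _) (hh1 _))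
  have hBi : Integrable B P := integrable_finsetSum _ fun i _ =>
    integrable_of_abs_le
      (((hh.comp (hZi _).fst).mul (hh.comp (hZi _).fst)).sub ((hh.comp (hZi _).fst).pow_const 2))
      fun ω => abs_sub_le_one_of_mem (hmul (hh1 _) (hh1 _)) (hsq (hh1 _))
  have hCi : Integrable C P := integrable_finsetSum _ fun i _ =>
    (integrable_of_abs_le ((hh.comp (hz i).fst).pow_const 2)
      fun ω => abs_le_one_of_mem (hsq (hh1 _))).sub (integrable_const _)
  have hDi : Integrable D P := integrable_finsetSum _ fun i _ =>
    (integrable_of_abs_le ((hφ.comp (hz i).snd).pow_const 2)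
      fun ω => abs_le_one_of_mem (hsq (hφ1 _))).sub (integrable_const _)
  have hpt : ∀ ω, |∑ i : Fin m, (φ (z (σ ω i.succ) ω).2 - φ (z (σ ω i.castSucc) ω).2) ^ 2 -
        (m + 1) * (2 * (∫ s, φ s.2 ^ 2 ∂ρ - ∫ s, h s.1 ^ 2 ∂ρ))| ≤
      2 * |A ω| + 2 * |B ω| + 2 * |C ω| + 2 * |D ω| + 4 := by
    intro ω
    have h1 := sum_sq_succ_sub fun i => φ (z (σ ω i) ω).2
    have h2 : D ω = ∑ i, φ (z (σ ω i) ω).2 ^ 2 - (m + 1) * ∫ s, φ s.2 ^ 2 ∂ρ := by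
      rw [hDdef, Equiv.sum_comp (σ ω) fun i => φ (z i ω).2 ^ 2]
      simp [Finset.sum_sub_distrib]
    have h3 : C ω = ∑ i, h (z (σ ω i) ω).1 ^ 2 - (m + 1) * ∫ s, h s.1 ^ 2 ∂ρ := by
      rw [hCdef, Equiv.sum_comp (σ ω) fun i => h (z i ω).1 ^ 2]
      simp [Finset.sum_sub_distrib]
    have h4 := Fin.sum_univ_castSucc fun i => h (z (σ ω i) ω).1 ^ 2
    have h5 : A ω + B ω = ∑ i : Fin m, φ (z (σ ω i.castSucc) ω).2 * φ (z (σ ω i.succ) ω).2 -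
        ∑ i : Fin m, h (z (σ ω i.castSucc) ω).1 ^ 2 := by
      simp only [hAdef, hBdef, Finset.sum_sub_distrib]
      ring
    have q1 := hsq (hφ1 (z (σ ω 0) ω).2)
    have q2 := hsq (hφ1 (z (σ ω (Fin.last m)) ω).2)
    have q3 := hsq (hh1 (z (σ ω (Fin.last m)) ω).1)
    have a1 := abs_le.1 (le_refl |A ω|)
    have a2 := abs_le.1 (le_refl |B ω|)
    have a3 := abs_le.1 (le_refl |C ω|)
    have a4 := abs_le.1 (le_refl |D ω|)
    rw [Set.mem_Icc] at q1 q2 q3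
    refine abs_le.2 ⟨?_, ?_⟩ <;> linarith
  have hI : Integrable (fun ω => 2 * |A ω| + 2 * |B ω| + 2 * |C ω| + 2 * |D ω| + 4) P :=
    ((((hAi.abs.const_mul 2).add (hBi.abs.const_mul 2)).add (hCi.abs.const_mul 2)).add
      (hDi.abs.const_mul 2)).add (integrable_const _)
  have hint : ∫ ω, (2 * |A ω| + 2 * |B ω| + 2 * |C ω| + 2 * |D ω| + 4) ∂P =
      2 * ∫ ω, |A ω| ∂P + 2 * ∫ ω, |B ω| ∂P + 2 * ∫ ω, |C ω| ∂P + 2 * ∫ ω, |D ω| ∂P + 4 := by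
    rw [integral_add, integral_add, integral_add, integral_add, integral_const_mul,
      integral_const_mul, integral_const_mul, integral_const_mul]
    · simp
    · exact hAi.abs.const_mul 2
    · exact hBi.abs.const_mul 2
    · exact (hAi.abs.const_mul 2).add (hBi.abs.const_mul 2)
    · exact hCi.abs.const_mul 2
    · exact ((hAi.abs.const_mul 2).add (hBi.abs.const_mul 2)).add (hCi.abs.const_mul 2)
    · exact hDi.abs.const_mul 2
    · exact (((hAi.abs.const_mul 2).add (hBi.abs.const_mul 2)).add (hCi.abs.const_mul 2)).add
        (hDi.abs.const_mul 2)
    · exact integrable_const _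
  refine (integral_mono_of_nonneg (ae_of_all _ fun _ => abs_nonneg _) hI
    (ae_of_all _ hpt)).trans ?_
  rw [hint]
  have hs : √(m : ℝ) ≤ √((m : ℝ) + 1) := Real.sqrt_le_sqrt (by linarith)
  push_cast at hC hD
  linarith

end Noise

/-! ### Approximation by functions of small variation, and averages over pairs. -/

/-- Integrable functions are approximated in `L¹` by functions whose variation along monotone
sequences grows arbitrarily slowly. -/
theorem exists_approx_small_variation (ν : Measure ℝ) [IsFiniteMeasure ν] {h : ℝ → ℝ}
    (hh : Integrable h ν) {δ : ℝ} (hδ : 0 < δ) :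
    ∃ (g : ℝ → ℝ) (K : ℝ), Integrable (fun x => h x - g x) ν ∧ ∫ x, |h x - g x| ∂ν ≤ δ ∧
      ∀ (m : ℕ) (v : Fin (m + 1) → ℝ), Monotone v →
        ∑ i : Fin m, |g (v i.succ) - g (v i.castSucc)| ≤ m * δ + K := by
  obtain ⟨g, hgs, hgδ, hgc, hgi⟩ := hh.exists_hasCompactSupport_integral_sub_le hδ
  obtain ⟨η, hη, hunif⟩ := Metric.uniformContinuous_iff.1
    (hgs.uniformContinuous_of_continuous hgc) δ hδ
  obtain ⟨B, hB⟩ := hgs.exists_bound_of_continuous hgc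
  obtain ⟨M, hM⟩ := hgs.isCompact.isBounded.subset_closedBall 0
  set M' := max M 0 + 1 with hM'
  have hM0 : 0 < M' := by positivity
  have hzero : ∀ x, M' ≤ |x| → g x = 0 := fun x hx => by
    by_contra hne
    have := hM (subset_tsupport g hne)
    rw [mem_closedBall_zero_iff, Real.norm_eq_abs] at this
    have := le_max_left M 0
    linarith
  -- Clamping to `[-M', M']` does not change `g`, which vanishes at the endpoints and beyond, and it
  -- bounds the variation of any monotone sequence by `2 * M'`.
  set cl : ℝ → ℝ := fun x => max (-M') (min x M') with hcl
  have hclmono : Monotone cl := fun a b hab => max_le_max le_rfl (min_le_min hab le_rfl)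
  have hgcl : ∀ x, g (cl x) = g x := fun x => by
    simp only [hcl]
    rcases le_total x M' with h1 | h1
    · rw [min_eq_left h1]
      rcases le_total (-M') x with h2 | h2
      · rw [max_eq_right h2]
      · rw [max_eq_left h2, hzero _ (by rw [abs_neg]; exact le_abs_self _),
          hzero x (by rw [le_abs]; right; linarith)]
    · rw [min_eq_right h1, max_eq_right (by linarith), hzero _ (le_abs_self _),
        hzero x (h1.trans (le_abs_self _))]
  have hB0 : 0 ≤ B := (norm_nonneg _).trans (hB 0)
  -- If the clamped points are closer than `η`, uniform continuity gives `δ`; otherwise the trivial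
  -- bound `2 * B` is at most `2 * B / η` times their distance.
  have hstep : ∀ a b, |g a - g b| ≤ δ + 2 * B / η * |cl a - cl b| := fun a b => by
    rw [← hgcl a, ← hgcl b]
    rcases lt_or_ge |cl a - cl b| η with hlt | hge
    · have := hunif (a := cl a) (b := cl b) hlt
      rw [Real.dist_eq] at this
      have : 0 ≤ 2 * B / η * |cl a - cl b| := by positivity
      linarith
    · have h1 := hB (cl a)
      have h2 := hB (cl b)
      rw [Real.norm_eq_abs] at h1 h2
      have h3 : 2 * B ≤ 2 * B / η * |cl a - cl b| := by
        rw [div_mul_eq_mul_div, le_div_iff₀ hη]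
        gcongr
      have h4 := abs_sub (g (cl a)) (g (cl b))
      linarith
  refine ⟨g, 2 * B / η * (2 * M'), hh.sub hgi, by simpa using hgδ, fun m v hv => ?_⟩
  have htv : ∑ i : Fin m, |cl (v i.succ) - cl (v i.castSucc)| ≤ 2 * M' := by
    rw [sum_abs_succ_sub_of_monotone (f := fun i => cl (v i)) (hclmono.comp hv)]
    have h1 : cl (v (Fin.last m)) ≤ M' := max_le (by linarith) (min_le_right _ _)
    have h2 : -M' ≤ cl (v 0) := le_max_left _ _
    linarith
  calc ∑ i : Fin m, |g (v i.succ) - g (v i.castSucc)|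
      ≤ ∑ i : Fin m, (δ + 2 * B / η * |cl (v i.succ) - cl (v i.castSucc)|) :=
        Finset.sum_le_sum fun i _ => hstep _ _
    _ = m * δ + 2 * B / η * ∑ i : Fin m, |cl (v i.succ) - cl (v i.castSucc)| := by
        rw [Finset.sum_add_distrib, ← Finset.mul_sum]
        simp
    _ ≤ _ := by gcongr

theorem tendsto_add_one_inv_sqrt : Tendsto (fun m : ℕ => (√((m : ℝ) + 1))⁻¹) atTop (𝓝 0) :=
  tendsto_inv_atTop_zero.comp (Real.tendsto_sqrt_atTop.comp
    (tendsto_atTop_add_const_right _ _ tendsto_natCast_atTop_atTop))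

theorem sqrt_div_self_add_one (m : ℕ) : √((m : ℝ) + 1) / (m + 1) = (√((m : ℝ) + 1))⁻¹ := by
  rw [Real.sqrt_div_self', one_div]

/-- The empirical average of `b (z i) ·` is close to its mean, for the fixed index `i`. -/
theorem integral_abs_sum_pair_sub_le {Ω α : Type*} [MeasurableSpace Ω] [MeasurableSpace α]
    {P : Measure Ω} [IsProbabilityMeasure P] {n : ℕ} {z : Fin n → Ω → α}
    (hz : ∀ i, Measurable (z i)) (hind : iIndepFun z P) {ρ : Measure α} [IsProbabilityMeasure ρ]
    (hρ : ∀ i, P.map (z i) = ρ) {b : α × α → ℝ} (hb : Measurable b)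
    (hb1 : ∀ p, b p ∈ Set.Icc (0 : ℝ) 1) (i : Fin n) :
    ∫ ω, |∑ k, (b (z i ω, z k ω) - ∫ s, b (z i ω, s) ∂ρ)| ∂P ≤ √n + 1 := by
  set B : α → ℝ := fun u => ∫ s, b (u, s) ∂ρ with hB
  have hBm : Measurable B := (hb.stronglyMeasurable.integral_prod_right').measurable
  have hbi : ∀ u, Integrable (fun s => b (u, s)) ρ := fun u =>
    integrable_of_abs_le (hb.comp (measurable_const.prodMk measurable_id)) fun s =>
      abs_le_one_of_mem (hb1 _)
  have hB1 : ∀ u, B u ∈ Set.Icc (0 : ℝ) 1 := fun u => by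
    refine ⟨integral_nonneg fun s => (hb1 _).1, ?_⟩
    have := integral_mono (hbi u) (integrable_const (1 : ℝ)) fun s => (hb1 _).2
    simpa using this
  have hsub : ∀ u s, |b (u, s) - B u| ≤ 1 := fun u s => abs_sub_le_one_of_mem (hb1 _) (hB1 _)
  have hm : ∀ k, Measurable fun ω => b (z i ω, z k ω) - B (z i ω) := fun k =>
    (hb.comp ((hz i).prodMk (hz k))).sub (hBm.comp (hz i))
  -- The diagonal term `k = i` need not be centred given `z i`; it is split off and costs the extra
  -- 1. The other terms are centred given `z i`, hence orthogonal.
  have horth := integral_abs_sum_le_sqrt (P := P) (Finset.univ.erase i)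
    (a := fun k ω => b (z i ω, z k ω) - B (z i ω)) hm (fun k ω => hsub _ _)
    fun k hk l hl hkl => by
      have hik : i ≠ k := (Finset.ne_of_mem_erase hk).symm
      refine integral_eq_zero_of_forall_integral_update hz hind k
        (f := fun v => (b (v i, v k) - B (v i)) * (b (v i, v l) - B (v i))) ?_ (C := 1)
        (fun v => ?_) fun v => ?_
      · have hp : ∀ j, Measurable fun v : Fin n → α => b (v i, v j) - B (v i) := fun j =>
          (hb.comp ((measurable_pi_apply i).prodMk (measurable_pi_apply j))).sub
            (hBm.comp (measurable_pi_apply i))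
        exact (hp k).mul (hp l)
      · rw [abs_mul]
        exact mul_le_one₀ (hsub _ _) (abs_nonneg _) (hsub _ _)
      · simp only [Function.update_self, Function.update_of_ne hik, Function.update_of_ne hkl.symm]
        rw [hρ, integral_mul_const, integral_sub (hbi _) (integrable_const _)]
        simp [hB]
  have hcard : √((Finset.univ.erase i).card : ℝ) ≤ √n := by
    refine Real.sqrt_le_sqrt (Nat.cast_le.2 ?_)
    simp
  have hI : Integrable (fun ω => |∑ k ∈ Finset.univ.erase i,
      (b (z i ω, z k ω) - B (z i ω))|) P :=
    (integrable_finsetSum _ fun k _ => integrable_of_abs_le (hm k) fun ω => hsub _ _).abs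
  calc _ ≤ ∫ ω, (|∑ k ∈ Finset.univ.erase i, (b (z i ω, z k ω) - B (z i ω))| + 1) ∂P := by
        refine integral_mono_of_nonneg (ae_of_all _ fun _ => abs_nonneg _)
          (hI.add (integrable_const _)) (ae_of_all _ fun ω => ?_)
        simp only
        rw [← Finset.sum_erase_add _ _ (Finset.mem_univ i)]
        exact (abs_add_le _ _).trans (add_le_add le_rfl (hsub _ _))
    _ ≤ √n + 1 := by
        rw [integral_add hI (integrable_const _)]
        simp only [integral_const, probReal_univ, smul_eq_mul, mul_one]
        linarith

/-! ### Threshold indicators and conditional survival functions. -/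

/-- The indicator function `1_{t ≤ y}`. -/
noncomputable def leInd (t y : ℝ) : ℝ := if t ≤ y then 1 else 0

theorem leInd_mem (t y : ℝ) : leInd t y ∈ Set.Icc (0 : ℝ) 1 := by
  unfold leInd; split_ifs <;> simp

theorem leInd_sq (t y : ℝ) : leInd t y ^ 2 = leInd t y := by
  unfold leInd; split_ifs <;> simp

theorem measurable_leInd : Measurable fun p : ℝ × ℝ => leInd p.1 p.2 :=
  Measurable.ite (measurableSet_le measurable_fst measurable_snd) measurable_const measurable_const

theorem measurable_leInd_comp {α : Type*} [MeasurableSpace α] {f g : α → ℝ} (hf : Measurable f)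
    (hg : Measurable g) : Measurable fun a => leInd (f a) (g a) :=
  measurable_leInd.comp (hf.prodMk hg)

/-- Conditional survival functions: `h t x` is a version of `P(Y ≥ t | X = x)` for the joint
law `ρ` of `(X, Y)`. -/
structure IsCondSurvival (ρ : Measure (ℝ × ℝ)) (h : ℝ → ℝ → ℝ) : Prop where
  measurable : Measurable fun p : ℝ × ℝ => h p.1 p.2
  mem : ∀ t x, h t x ∈ Set.Icc (0 : ℝ) 1
  integral_mul : ∀ t, ∀ ψ : ℝ → ℝ, Measurable ψ → (∃ C, ∀ x, |ψ x| ≤ C) →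
    ∫ s, ψ s.1 * (leInd t s.2 - h t s.1) ∂ρ = 0

theorem integrable_leInd_left {μ : Measure ℝ} [IsProbabilityMeasure μ] (a : ℝ) :
    Integrable (fun t => leInd t a) μ :=
  integrable_of_abs_le (measurable_leInd_comp measurable_id measurable_const)
    fun _ => abs_le_one_of_mem (leInd_mem _ _)

/-- The indicator is monotone in its second argument, so the difference has the same sign for all
`t` and values in `{0, 1}` or `{0, -1}`; up to sign it equals its square. This turns increments of
the distribution function into squared increments. -/
theorem abs_integral_leInd_sub {μ : Measure ℝ} [IsProbabilityMeasure μ] (a b : ℝ) :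
    |∫ t, leInd t a ∂μ - ∫ t, leInd t b ∂μ| = ∫ t, (leInd t a - leInd t b) ^ 2 ∂μ := by
  rw [← integral_sub (integrable_leInd_left a) (integrable_leInd_left b)]
  rcases le_total a b with hab | hab
  · have : ∀ t, leInd t a - leInd t b = -(leInd t a - leInd t b) ^ 2 := fun t => by
      unfold leInd
      split_ifs with h1 h2 <;> linarith
    rw [integral_congr_ae (ae_of_all _ this), integral_neg, abs_neg, abs_of_nonneg]
    exact integral_nonneg fun _ => sq_nonneg _
  · have : ∀ t, leInd t a - leInd t b = (leInd t a - leInd t b) ^ 2 := fun t => by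
      unfold leInd
      split_ifs with h1 h2 <;> linarith
    rw [integral_congr_ae (ae_of_all _ this), abs_of_nonneg]
    exact integral_nonneg fun _ => sq_nonneg _

/-- The sum of squared increments of the indicators along the sorted sample. -/
noncomputable def sqIncrements {Ω : Type*} (z : ℕ → Ω → ℝ × ℝ)
    (σ : (n : ℕ) → Ω → Equiv.Perm (Fin n)) (m : ℕ)
    (t : ℝ) (ω : Ω) : ℝ :=
  ∑ i : Fin m, (leInd t (z (σ (m + 1) ω i.succ) ω).2 -
    leInd t (z (σ (m + 1) ω i.castSucc) ω).2) ^ 2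

theorem abs_sqIncrements_div_le {Ω : Type*} {z : ℕ → Ω → ℝ × ℝ}
    {σ : (n : ℕ) → Ω → Equiv.Perm (Fin n)} (m : ℕ) (t : ℝ) (ω : Ω) :
    |sqIncrements z σ m t ω / (m + 1)| ≤ 1 := by
  have hpos : (0 : ℝ) < (m : ℝ) + 1 := by positivity
  rw [abs_div, abs_of_pos hpos, div_le_one hpos]
  refine (Finset.abs_sum_le_sum_abs _ _).trans ?_
  have : ∑ i : Fin m, |(leInd t (z (σ (m + 1) ω i.succ) ω).2 -
      leInd t (z (σ (m + 1) ω i.castSucc) ω).2) ^ 2| ≤ ∑ _i : Fin m, (1 : ℝ) := by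
    refine Finset.sum_le_sum fun i _ => ?_
    rw [abs_pow]
    exact pow_le_one₀ (abs_nonneg _) (abs_sub_le_one_of_mem (leInd_mem _ _) (leInd_mem _ _))
  refine this.trans ?_
  simp

theorem tendsto_integral_integral_of_tendsto {Ω : Type*} [MeasurableSpace Ω] {P : Measure Ω}
    [IsProbabilityMeasure P] {μ : Measure ℝ} [IsProbabilityMeasure μ] {f : ℕ → ℝ → Ω → ℝ}
    (hm : ∀ m, Measurable fun p : ℝ × Ω => f m p.1 p.2) {C : ℝ} (hb : ∀ m t ω, |f m t ω| ≤ C)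
    (hf : ∀ t, Tendsto (fun m => ∫ ω, f m t ω ∂P) atTop (𝓝 0)) :
    Tendsto (fun m => ∫ ω, ∫ t, f m t ω ∂μ ∂P) atTop (𝓝 0) := by
  have hswap : ∀ m, ∫ ω, ∫ t, f m t ω ∂μ ∂P = ∫ t, ∫ ω, f m t ω ∂P ∂μ := fun m =>
    (integral_integral_swap (f := f m) (integrable_of_abs_le (C := C) (hm m)
      fun p => hb m p.1 p.2)).symm
  simp_rw [hswap]
  have := tendsto_integral_of_dominated_convergence (μ := μ) (fun _ => C)
    (F := fun m t => ∫ ω, f m t ω ∂P) (f := fun _ => 0)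
    (fun m => ((hm m).stronglyMeasurable.integral_prod_right').aestronglyMeasurable)
    (integrable_const _)
    (fun m => ae_of_all _ fun t => by
      have := norm_integral_le_of_norm_le_const (μ := P) (f := f m t) (ae_of_all _ fun ω => hb m t ω)
      simpa using this)
    (ae_of_all _ hf)
  simpa using this

/-! ### Convergence of the squared increments. -/

section Limits

variable {Ω : Type*} [MeasurableSpace Ω] {P : Measure Ω} [IsProbabilityMeasure P]
  {z : ℕ → Ω → ℝ × ℝ} {ρ : Measure (ℝ × ℝ)} {σ : (n : ℕ) → Ω → Equiv.Perm (Fin n)}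

/-- The limit of the normalized sums of squared increments. -/
noncomputable def incrementLimit (ρ : Measure (ℝ × ℝ)) (h : ℝ → ℝ → ℝ) (t : ℝ) : ℝ :=
  2 * (∫ s, leInd t s.2 ∂ρ - ∫ s, h t s.1 ^ 2 ∂ρ)

theorem tendsto_integral_abs_sqIncrements [IsProbabilityMeasure ρ] (hz : ∀ i, Measurable (z i))
    (hind : iIndepFun z P) (hρ : ∀ i, P.map (z i) = ρ)
    (hσ : ∀ n, IsUniformTieBreaking P (fun ω (i : Fin n) => (z i ω).1)
      (fun ω (i : Fin n) => (z i ω).2) (σ n))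
    {h : ℝ → ℝ → ℝ} (hh : IsCondSurvival ρ h) (t : ℝ) :
    Tendsto (fun m : ℕ => ∫ ω, |sqIncrements z σ m t ω / (m + 1) - incrementLimit ρ h t| ∂P)
      atTop (𝓝 0) := by
  have hht : Measurable (h t) := hh.measurable.comp (measurable_const.prodMk measurable_id)
  have := Measure.isProbabilityMeasure_map (μ := ρ) (measurable_fst (α := ℝ) (β := ℝ)).aemeasurable
  have hi : Integrable (h t) (ρ.map Prod.fst) :=
    integrable_of_abs_le hht fun x => abs_le_one_of_mem (hh.mem t x)
  refine tendsto_order.2 ⟨fun a ha => Eventually.of_forall fun m =>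
    ha.trans_le (integral_nonneg fun _ => abs_nonneg _), fun a ha => ?_⟩
  -- After division by `m + 1` the approximation contributes at most `2δ` from the variation and
  -- `4δ` from the `L¹` error, so `δ = a / 12` uses up `a / 2`; the other half is left for the terms
  -- tending to 0.
  obtain ⟨g, K, hgi, hgδ, hgK⟩ := exists_approx_small_variation _ hi (δ := a / 12) (by positivity)
  have hgi' : Integrable (fun s : ℝ × ℝ => h t s.1 - g s.1) ρ := hgi.comp_measurable measurable_fst
  have hgint : ∫ s, |h t s.1 - g s.1| ∂ρ ≤ a / 12 := by
    rwa [integral_map measurable_fst.aemeasurable hgi.abs.aestronglyMeasurable] at hgδ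
  have hlim : Tendsto (fun m : ℕ => 8 * (√((m : ℝ) + 1))⁻¹ + (4 + 2 * K) * ((m : ℝ) + 1)⁻¹)
      atTop (𝓝 0) := by
    have h1 : Tendsto (fun m : ℕ => ((m : ℝ) + 1)⁻¹) atTop (𝓝 0) := by
      simpa [one_div] using tendsto_one_div_add_atTop_nhds_zero_nat (𝕜 := ℝ)
    simpa using (tendsto_add_one_inv_sqrt.const_mul 8).add (h1.const_mul (4 + 2 * K))
  filter_upwards [hlim.eventually_lt_const (show (0 : ℝ) < a / 2 by positivity)] with m hm
  have hpos : (0 : ℝ) < (m : ℝ) + 1 := by positivity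
  have hmain := integral_abs_sum_sq_sub_le (z := fun i : Fin (m + 1) => z i) (fun i => hz i)
    (hind.precomp Fin.val_injective) (fun i => hρ i) (hσ (m + 1)) (φ := leInd t)
    (measurable_leInd_comp measurable_const measurable_id) (leInd_mem t) hht (hh.mem t)
    (hh.integral_mul t) hgi' (hgK m)
  simp only [leInd_sq] at hmain
  have heq : ∀ ω, |sqIncrements z σ m t ω / (m + 1) - incrementLimit ρ h t| =
      |sqIncrements z σ m t ω - (m + 1) * incrementLimit ρ h t| / (m + 1) := fun ω => by
    rw [← abs_of_pos hpos, ← abs_div, abs_of_pos hpos]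
    congr 1
    field_simp
  simp_rw [heq]
  rw [integral_div, div_lt_iff₀ hpos]
  refine lt_of_le_of_lt hmain ?_
  have h2 : √((m : ℝ) + 1) = (√((m : ℝ) + 1))⁻¹ * (m + 1) := by
    rw [← sqrt_div_self_add_one]; field_simp
  have h3 : 4 + 2 * K = (4 + 2 * K) * ((m : ℝ) + 1)⁻¹ * (m + 1) := by field_simp
  have h4 : ((m : ℝ) + 1) * ∫ s, |h t s.1 - g s.1| ∂ρ ≤ (m + 1) * (a / 12) := by gcongr
  have h5 := mul_lt_mul_of_pos_right hm hpos
  nlinarith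

theorem measurable_sqIncrements (hz : ∀ i, Measurable (z i))
    (hσ : ∀ n π, MeasurableSet {ω | σ n ω = π}) (m : ℕ) :
    Measurable fun p : ℝ × Ω => sqIncrements z σ m p.1 p.2 := by
  have hZ := measurable_sorted (z := fun i : Fin (m + 1) => z i) (fun i => hz i) (hσ (m + 1))
  have hZi : ∀ i : Fin (m + 1), Measurable fun ω => (z (σ (m + 1) ω i) ω).2 := fun i =>
    ((measurable_pi_apply i).comp hZ).snd
  exact Finset.measurable_sum _ fun i _ =>
    ((measurable_leInd_comp measurable_fst ((hZi _).comp measurable_snd)).sub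
      (measurable_leInd_comp measurable_fst ((hZi _).comp measurable_snd))).pow_const 2

theorem IsCondSurvival.measurable_incrementLimit [IsProbabilityMeasure ρ] {h : ℝ → ℝ → ℝ}
    (hh : IsCondSurvival ρ h) : Measurable (incrementLimit ρ h) := by
  have h1 : Measurable fun t => ∫ s, leInd t s.2 ∂ρ :=
    (StronglyMeasurable.integral_prod_right' (f := fun p : ℝ × (ℝ × ℝ) => leInd p.1 p.2.2)
      (measurable_leInd_comp measurable_fst measurable_snd.snd).stronglyMeasurable).measurable
  have h2 : Measurable fun t => ∫ s, h t s.1 ^ 2 ∂ρ :=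
    (StronglyMeasurable.integral_prod_right' (f := fun p : ℝ × (ℝ × ℝ) => h p.1 p.2.1 ^ 2)
      ((hh.measurable.comp (measurable_fst.prodMk measurable_snd.fst)).pow_const
        2).stronglyMeasurable).measurable
  exact (h1.sub h2).const_mul 2

theorem integral_mem_of_mem {α : Type*} [MeasurableSpace α] {ν : Measure α}
    [IsProbabilityMeasure ν] {f : α → ℝ} (hf : Measurable f) (h : ∀ a, f a ∈ Set.Icc (0 : ℝ) 1) :
    ∫ a, f a ∂ν ∈ Set.Icc (0 : ℝ) 1 := by
  refine ⟨integral_nonneg fun s => (h _).1, ?_⟩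
  have := integral_mono (integrable_of_abs_le (P := ν) hf fun a => abs_le_one_of_mem (h a))
    (integrable_const (1 : ℝ)) fun s => (h _).2
  simpa using this

theorem IsCondSurvival.sq_mem {h : ℝ → ℝ → ℝ} (hh : IsCondSurvival ρ h) (t x : ℝ) :
    h t x ^ 2 ∈ Set.Icc (0 : ℝ) 1 :=
  ⟨by positivity, pow_le_one₀ (hh.mem t x).1 (hh.mem t x).2⟩

theorem IsCondSurvival.abs_incrementLimit_le [IsProbabilityMeasure ρ] {h : ℝ → ℝ → ℝ}
    (hh : IsCondSurvival ρ h) (t : ℝ) : |incrementLimit ρ h t| ≤ 2 := by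
  have h1 : ∫ s, leInd t s.2 ∂ρ ∈ Set.Icc (0 : ℝ) 1 :=
    integral_mem_of_mem (measurable_leInd_comp measurable_const measurable_snd)
      fun s => leInd_mem _ _
  have h2 : ∫ s, h t s.1 ^ 2 ∂ρ ∈ Set.Icc (0 : ℝ) 1 :=
    integral_mem_of_mem ((hh.measurable.comp (measurable_const.prodMk measurable_fst)).pow_const 2)
      fun s => hh.sq_mem _ _
  have := abs_sub_le_one_of_mem h1 h2
  rw [incrementLimit, abs_mul, abs_two]
  linarith

/-- The integrated version, over the law `μ` of `Y`. -/
theorem tendsto_integral_integral_abs_sqIncrements [IsProbabilityMeasure ρ]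
    (hz : ∀ i, Measurable (z i))
    (hind : iIndepFun z P) (hρ : ∀ i, P.map (z i) = ρ)
    (hσ : ∀ n, IsUniformTieBreaking P (fun ω (i : Fin n) => (z i ω).1)
      (fun ω (i : Fin n) => (z i ω).2) (σ n))
    {h : ℝ → ℝ → ℝ} (hh : IsCondSurvival ρ h) (μ : Measure ℝ) [IsProbabilityMeasure μ] :
    Tendsto (fun m : ℕ => ∫ ω, ∫ t, |sqIncrements z σ m t ω / (m + 1) - incrementLimit ρ h t| ∂μ ∂P)
      atTop (𝓝 0) := by
  have hm : ∀ m : ℕ, Measurable fun p : ℝ × Ω =>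
      |sqIncrements z σ m p.1 p.2 / (m + 1) - incrementLimit ρ h p.1| := fun m =>
    (((measurable_sqIncrements hz (fun n π => (hσ n π).1) m).div_const _).sub
      (hh.measurable_incrementLimit.comp measurable_fst)).abs
  have hb : ∀ (m : ℕ) t ω, |sqIncrements z σ m t ω / (m + 1) - incrementLimit ρ h t| ≤ 3 :=
    fun m t ω => by
      have h1 := abs_sqIncrements_div_le (z := z) (σ := σ) m t ω
      have h2 := hh.abs_incrementLimit_le t
      have h3 := abs_sub (sqIncrements z σ m t ω / (m + 1)) (incrementLimit ρ h t)
      linarith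
  exact tendsto_integral_integral_of_tendsto hm (fun m t ω => (abs_abs _).trans_le (hb m t ω))
    fun t => tendsto_integral_abs_sqIncrements hz hind hρ hσ hh t

end Limits

/-! ### Ranks and rank spread of an i.i.d. sample. -/

section Sample

variable {Ω : Type*} [MeasurableSpace Ω] {P : Measure Ω} [IsProbabilityMeasure P] {m : ℕ}
  {y : Fin (m + 1) → Ω → ℝ} {μ : Measure ℝ} [IsProbabilityMeasure μ]

theorem measurable_rankLE {n : ℕ} {y : Fin n → Ω → ℝ} (hy : ∀ i, Measurable (y i)) (i : Fin n) :
    Measurable fun ω => (rankLE (fun j => y j ω) i : ℝ) := by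
  simp_rw [rankLE_eq_sum]
  exact Finset.measurable_sum _ fun j _ =>
    Measurable.ite (measurableSet_le (hy j) (hy i)) measurable_const measurable_const

theorem measurable_rankGE {n : ℕ} {y : Fin n → Ω → ℝ} (hy : ∀ i, Measurable (y i)) (i : Fin n) :
    Measurable fun ω => (rankGE (fun j => y j ω) i : ℝ) := by
  simp_rw [rankGE_eq_sum]
  exact Finset.measurable_sum _ fun j _ =>
    Measurable.ite (measurableSet_le (hy i) (hy j)) measurable_const measurable_const

theorem integral_abs_rankLE_sub_le (hy : ∀ i, Measurable (y i)) (hind : iIndepFun y P)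
    (hμ : ∀ i, P.map (y i) = μ) (i : Fin (m + 1)) :
    ∫ ω, |(rankLE (fun j => y j ω) i : ℝ) - (m + 1) * ∫ t, leInd t (y i ω) ∂μ| ∂P ≤
      √(m + 1) + 1 := by
  have := integral_abs_sum_pair_sub_le hy hind hμ (b := fun p => leInd p.2 p.1)
    (measurable_leInd_comp measurable_snd measurable_fst) (fun p => leInd_mem _ _) i
  push_cast at this
  refine le_of_eq_of_le (integral_congr_ae (ae_of_all _ fun ω => ?_)) this
  simp only [Finset.sum_sub_distrib]
  rw [rankLE_eq_sum]
  simp [leInd]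

theorem integral_abs_rankGE_sub_le (hy : ∀ i, Measurable (y i)) (hind : iIndepFun y P)
    (hμ : ∀ i, P.map (y i) = μ) (i : Fin (m + 1)) :
    ∫ ω, |(rankGE (fun j => y j ω) i : ℝ) - (m + 1) * ∫ s, leInd (y i ω) s ∂μ| ∂P ≤
      √(m + 1) + 1 := by
  have := integral_abs_sum_pair_sub_le hy hind hμ (b := fun p => leInd p.1 p.2)
    (measurable_leInd_comp measurable_fst measurable_snd) (fun p => leInd_mem _ _) i
  push_cast at this
  refine le_of_eq_of_le (integral_congr_ae (ae_of_all _ fun ω => ?_)) this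
  simp only [Finset.sum_sub_distrib]
  rw [rankGE_eq_sum]
  simp [leInd]

/-- The limit of the normalized `∑ l_i (n - l_i)`. -/
noncomputable def spreadLimit (μ : Measure ℝ) : ℝ :=
  ∫ t, (∫ s, leInd t s ∂μ) * (1 - ∫ s, leInd t s ∂μ) ∂μ

theorem measurable_integral_leInd_right : Measurable fun t => ∫ s, leInd t s ∂μ :=
  (StronglyMeasurable.integral_prod_right' (f := fun p : ℝ × ℝ => leInd p.1 p.2)
    measurable_leInd.stronglyMeasurable).measurable

theorem measurable_integral_leInd_left : Measurable fun a => ∫ t, leInd t a ∂μ :=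
  (StronglyMeasurable.integral_prod_right' (f := fun p : ℝ × ℝ => leInd p.2 p.1)
    (measurable_leInd_comp measurable_snd measurable_fst).stronglyMeasurable).measurable

theorem integral_leInd_right_mem (t : ℝ) : ∫ s, leInd t s ∂μ ∈ Set.Icc (0 : ℝ) 1 :=
  integral_mem_of_mem (measurable_leInd_comp measurable_const measurable_id) fun _ => leInd_mem _ _

theorem integral_leInd_left_mem (a : ℝ) : ∫ t, leInd t a ∂μ ∈ Set.Icc (0 : ℝ) 1 :=
  integral_mem_of_mem (measurable_leInd_comp measurable_id measurable_const) fun _ => leInd_mem _ _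

theorem mul_one_sub_mem {a : ℝ} (ha : a ∈ Set.Icc (0 : ℝ) 1) : a * (1 - a) ∈ Set.Icc (0 : ℝ) 1 :=
  ⟨mul_nonneg ha.1 (sub_nonneg.2 ha.2),
    mul_le_one₀ ha.2 (sub_nonneg.2 ha.2) (by linarith [ha.1])⟩

theorem abs_mul_one_sub_sub_le {a b : ℝ} (ha : a ∈ Set.Icc (0 : ℝ) 1)
    (hb : b ∈ Set.Icc (0 : ℝ) 1) : |a * (1 - a) - b * (1 - b)| ≤ |a - b| := by
  have : a * (1 - a) - b * (1 - b) = (a - b) * (1 - a - b) := by ring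
  rw [this, abs_mul]
  exact mul_le_of_le_one_right (abs_nonneg _)
    (abs_le.2 ⟨by linarith [ha.2, hb.2], by linarith [ha.1, hb.1]⟩)

theorem measurable_rankSpread {n : ℕ} {y : Fin n → Ω → ℝ} (hy : ∀ i, Measurable (y i)) :
    Measurable fun ω => rankSpread fun j => y j ω :=
  Finset.measurable_sum _ fun i _ =>
    (measurable_rankGE hy i).mul ((measurable_rankGE hy i).const_sub _)

/-- Replace `l_i / n` by `G (y_i)`, where `G t = μ [t, ∞)`. The map `u ↦ u (1 - u)` is 1-Lipschitz
on `[0, 1]`, so this costs the average rank error; the law of large numbers for `G (1 - G)` does the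
rest. -/
theorem integral_abs_rankSpread_sub_le (hy : ∀ i, Measurable (y i)) (hind : iIndepFun y P)
    (hμ : ∀ i, P.map (y i) = μ) :
    ∫ ω, |rankSpread (fun j => y j ω) / (m + 1) ^ 3 - spreadLimit μ| ∂P ≤
      2 * (√(m + 1))⁻¹ + ((m : ℝ) + 1)⁻¹ := by
  have hn : (0 : ℝ) < (m : ℝ) + 1 := by positivity
  set G : ℝ → ℝ := fun t => ∫ s, leInd t s ∂μ with hG
  have hGm : Measurable G := measurable_integral_leInd_right
  have hG1 : ∀ t, G t ∈ Set.Icc (0 : ℝ) 1 := integral_leInd_right_mem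
  have hlln := integral_abs_sum_sub_integral_le hy hind hμ (f := fun t => G t * (1 - G t))
    (hGm.mul (hGm.const_sub 1)) fun t => mul_one_sub_mem (hG1 t)
  have hrank := integral_abs_rankGE_sub_le hy hind hμ
  push_cast at hlln
  set e : Fin (m + 1) → Ω → ℝ := fun i ω =>
    |(rankGE (fun j => y j ω) i : ℝ) - (m + 1) * G (y i ω)| with he
  have hrk : ∀ i ω, (rankGE (fun j => y j ω) i : ℝ) ∈ Set.Icc (0 : ℝ) (m + 1) := fun i ω =>
    ⟨Nat.cast_nonneg _, by exact_mod_cast rankGE_le (fun j => y j ω) i⟩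
  have hei : ∀ i, Integrable (e i) P := fun i =>
    integrable_of_abs_le (C := (m + 1))
      (((measurable_rankGE hy i).sub ((hGm.comp (hy i)).const_mul _)).abs) fun ω => by
      have h1 := hrk i ω
      have h2 := hG1 (y i ω)
      have h3 := mul_le_mul_of_nonneg_left h2.2 hn.le
      have h4 := mul_nonneg hn.le h2.1
      rw [Set.mem_Icc] at h1
      rw [abs_abs]
      exact abs_le.2 ⟨by linarith, by linarith⟩
  set L : Ω → ℝ := fun ω => ∑ i, (G (y i ω) * (1 - G (y i ω)) - spreadLimit μ) with hL
  have hLi : Integrable L P := integrable_finsetSum _ fun i _ =>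
    (integrable_of_abs_le ((hGm.comp (hy i)).mul ((hGm.comp (hy i)).const_sub 1)) fun ω =>
      abs_le_one_of_mem (mul_one_sub_mem (hG1 _))).sub (integrable_const _)
  have hpt : ∀ ω, |rankSpread (fun j => y j ω) / (m + 1) ^ 3 - spreadLimit μ| ≤
      (∑ i, e i ω) / (m + 1) ^ 2 + |L ω| / (m + 1) := by
    intro ω
    have h1 : rankSpread (fun j => y j ω) / (m + 1) ^ 3 - spreadLimit μ =
        (∑ i, ((rankGE (fun j => y j ω) i / (m + 1)) * (1 - rankGE (fun j => y j ω) i / (m + 1)) -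
          G (y i ω) * (1 - G (y i ω)))) / (m + 1) + L ω / (m + 1) := by
      rw [← add_div, hL, ← Finset.sum_add_distrib]
      simp only [sub_add_sub_cancel, Finset.sum_sub_distrib, Finset.sum_const, Finset.card_univ,
        Fintype.card_fin, nsmul_eq_mul, rankSpread]
      push_cast
      rw [sub_div, mul_div_cancel_left₀ _ hn.ne', Finset.sum_div, Finset.sum_div]
      congr 1
      refine Finset.sum_congr rfl fun i _ => ?_
      field_simp
    rw [h1]
    refine (abs_add_le _ _).trans (add_le_add ?_ ?_)
    · rw [abs_div, abs_of_pos hn, sq, ← div_div]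
      gcongr
      rw [Finset.sum_div]
      refine (Finset.abs_sum_le_sum_abs _ _).trans (Finset.sum_le_sum fun i _ => ?_)
      have h2 := hrk i ω
      refine (abs_mul_one_sub_sub_le ⟨div_nonneg h2.1 hn.le, (div_le_one hn).2 h2.2⟩
        (hG1 _)).trans_eq ?_
      rw [he]
      simp only
      rw [← abs_of_pos hn, ← abs_div, abs_of_pos hn]
      congr 1
      field_simp
    · rw [abs_div, abs_of_pos hn]
  have hsi : Integrable (fun ω => (∑ i, e i ω) / ((m : ℝ) + 1) ^ 2) P :=
    (integrable_finsetSum _ fun i _ => hei i).div_const _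
  refine (integral_mono_of_nonneg (ae_of_all _ fun _ => abs_nonneg _)
    (hsi.add (hLi.abs.div_const _)) (ae_of_all _ hpt)).trans ?_
  rw [integral_add' hsi (hLi.abs.div_const _), integral_div, integral_div,
    integral_finsetSum _ fun i _ => hei i]
  have h5 : ∑ i, ∫ ω, e i ω ∂P ≤ (m + 1) * (√(m + 1) + 1) := by
    refine (Finset.sum_le_sum fun i _ => hrank i).trans_eq ?_
    rw [Finset.sum_const, Finset.card_univ, Fintype.card_fin, nsmul_eq_mul]
    push_cast
    rfl
  calc _ ≤ (m + 1) * (√((m : ℝ) + 1) + 1) / (m + 1) ^ 2 + √((m : ℝ) + 1) / (m + 1) := by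
        gcongr
        exact hlln
    _ = 2 * (√((m : ℝ) + 1) / (m + 1)) + ((m : ℝ) + 1)⁻¹ := by field_simp; ring
    _ = _ := by rw [sqrt_div_self_add_one]

theorem tendsto_add_one_inv : Tendsto (fun m : ℕ => ((m : ℝ) + 1)⁻¹) atTop (𝓝 0) := by
  simpa [one_div] using tendsto_one_div_add_atTop_nhds_zero_nat (𝕜 := ℝ)

end Sample

/-! ### From rank variation to squared increments. -/

theorem abs_abs_sub_sub_mul_le {c : ℝ} (hc : 0 ≤ c) (a b u v : ℝ) :
    abs (|a - b| - c * |u - v|) ≤ |a - c * u| + |b - c * v| := by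
  have h1 : c * |u - v| = |c * u - c * v| := by rw [← mul_sub, abs_mul, abs_of_nonneg hc]
  rw [h1, ← abs_neg (b - c * v)]
  refine (abs_abs_sub_abs_le _ _).trans (le_trans (le_of_eq ?_) (abs_add_le _ _))
  congr 1
  ring

theorem abs_sum_abs_sub_sub_le {c : ℝ} (hc : 0 ≤ c) {m : ℕ} (r F : Fin (m + 1) → ℝ)
    (τ : Equiv.Perm (Fin (m + 1))) :
    abs (∑ i : Fin m, |r (τ i.succ) - r (τ i.castSucc)| -
      c * ∑ i : Fin m, |F (τ i.succ) - F (τ i.castSucc)|) ≤ 2 * ∑ j, |r j - c * F j| := by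
  rw [Finset.mul_sum, ← Finset.sum_sub_distrib]
  refine (Finset.abs_sum_le_sum_abs _ _).trans ((Finset.sum_le_sum fun i _ =>
    abs_abs_sub_sub_mul_le hc _ _ _ _).trans ?_)
  rw [Finset.sum_add_distrib]
  have h1 := Fin.sum_univ_succ fun i => |r (τ i) - c * F (τ i)|
  have h2 := Fin.sum_univ_castSucc fun i => |r (τ i) - c * F (τ i)|
  have h3 := Equiv.sum_comp τ fun j => |r j - c * F j|
  have h5 := abs_nonneg (r (τ 0) - c * F (τ 0))
  have h6 := abs_nonneg (r (τ (Fin.last m)) - c * F (τ (Fin.last m)))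
  linarith

/-- The first error comes from replacing ranks by `(m + 1) * F`, each index occurring in at most two
increments. The variation of `F` is then exactly the `μ`-integral of the squared increments, by
`abs_integral_leInd_sub`, which gives the second error. -/
theorem abs_rankVariation_sub_le {Ω : Type*} {z : ℕ → Ω → ℝ × ℝ} {ρ : Measure (ℝ × ℝ)}
    {σ : (n : ℕ) → Ω → Equiv.Perm (Fin n)} {μ : Measure ℝ} [IsProbabilityMeasure μ] {h : ℝ → ℝ → ℝ}
    [IsProbabilityMeasure ρ] (hh : IsCondSurvival ρ h) (m : ℕ) (ω : Ω) :
    |rankVariation (fun j : Fin (m + 1) => (z j ω).2) (σ (m + 1) ω) / ((m : ℝ) + 1) ^ 2 -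
      ∫ t, incrementLimit ρ h t ∂μ| ≤
    2 * ((∑ j : Fin (m + 1), |(rankLE (fun j : Fin (m + 1) => (z j ω).2) j : ℝ) -
      (m + 1) * ∫ t, leInd t (z j ω).2 ∂μ|) / ((m : ℝ) + 1) ^ 2) +
    ∫ t, |sqIncrements z σ m t ω / (m + 1) - incrementLimit ρ h t| ∂μ := by
  have hn : (0 : ℝ) < (m : ℝ) + 1 := by positivity
  set F : ℝ → ℝ := fun a => ∫ t, leInd t a ∂μ with hF
  set e : Fin (m + 1) → ℝ := fun j => |(rankLE (fun j : Fin (m + 1) => (z j ω).2) j : ℝ) -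
      (m + 1) * F (z j ω).2| with he
  set V := ∑ i : Fin m, |F (z (σ (m + 1) ω i.succ) ω).2 - F (z (σ (m + 1) ω i.castSucc) ω).2|
    with hV
  have hsqi : ∀ i : Fin m, Integrable (fun t => (leInd t (z (σ (m + 1) ω i.succ) ω).2 -
      leInd t (z (σ (m + 1) ω i.castSucc) ω).2) ^ 2) μ := fun i =>
    integrable_of_abs_le (C := 1)
      (((measurable_leInd_comp measurable_id measurable_const).sub
        (measurable_leInd_comp measurable_id measurable_const)).pow_const 2) fun t => by
      rw [abs_pow]
      exact pow_le_one₀ (abs_nonneg _) (abs_sub_le_one_of_mem (leInd_mem _ _) (leInd_mem _ _))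
  have hVint : V = ∫ t, sqIncrements z σ m t ω ∂μ := by
    simp only [hV, hF, abs_integral_leInd_sub, sqIncrements]
    rw [integral_finsetSum _ fun i _ => hsqi i]
  have hsi : Integrable (fun t => sqIncrements z σ m t ω / ((m : ℝ) + 1)) μ :=
    (integrable_finsetSum _ fun i _ => hsqi i).div_const _
  have hli : Integrable (incrementLimit ρ h) μ :=
    integrable_of_abs_le hh.measurable_incrementLimit hh.abs_incrementLimit_le
  have hdiff : |rankVariation (fun j : Fin (m + 1) => (z j ω).2) (σ (m + 1) ω) - (m + 1) * V| ≤
      2 * ∑ j, e j := by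
    rw [rankVariation, hV, he]
    exact abs_sum_abs_sub_sub_le hn.le
      (fun j => (rankLE (fun j : Fin (m + 1) => (z j ω).2) j : ℝ)) (fun j => F (z j ω).2)
      (σ (m + 1) ω)
  have hsplit : rankVariation (fun j : Fin (m + 1) => (z j ω).2) (σ (m + 1) ω) / ((m : ℝ) + 1) ^ 2 -
      ∫ t, incrementLimit ρ h t ∂μ =
      (rankVariation (fun j : Fin (m + 1) => (z j ω).2) (σ (m + 1) ω) - (m + 1) * V) /
        ((m : ℝ) + 1) ^ 2 +
      ∫ t, (sqIncrements z σ m t ω / (m + 1) - incrementLimit ρ h t) ∂μ := by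
    rw [integral_sub hsi hli, integral_div, ← hVint]
    field_simp
    ring
  rw [hsplit]
  refine (abs_add_le _ _).trans (add_le_add ?_ abs_integral_le_integral_abs)
  rw [abs_div, abs_of_pos (by positivity : (0 : ℝ) < ((m : ℝ) + 1) ^ 2), ← mul_div_assoc]
  gcongr

section Limits

variable {Ω : Type*} [MeasurableSpace Ω] {P : Measure Ω} [IsProbabilityMeasure P]
  {z : ℕ → Ω → ℝ × ℝ} {ρ : Measure (ℝ × ℝ)} {σ : (n : ℕ) → Ω → Equiv.Perm (Fin n)}

theorem tendsto_integral_abs_rankSpread {y : ℕ → Ω → ℝ} {μ : Measure ℝ} [IsProbabilityMeasure μ]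
    (hy : ∀ i, Measurable (y i)) (hind : iIndepFun y P) (hμ : ∀ i, P.map (y i) = μ) :
    Tendsto (fun m : ℕ => ∫ ω, |rankSpread (fun j : Fin (m + 1) => y j ω) / ((m : ℝ) + 1) ^ 3 -
      spreadLimit μ| ∂P) atTop (𝓝 0) := by
  refine squeeze_zero (fun m => integral_nonneg fun _ => abs_nonneg _)
    (fun m => integral_abs_rankSpread_sub_le (y := fun i : Fin (m + 1) => y i) (fun i => hy i)
      (hind.precomp Fin.val_injective) fun i => hμ i) ?_
  simpa using (tendsto_add_one_inv_sqrt.const_mul 2).add tendsto_add_one_inv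

theorem measurable_rankVariation (hz : ∀ i, Measurable (z i))
    (hσ : ∀ n π, MeasurableSet {ω | σ n ω = π}) (m : ℕ) :
    Measurable fun ω => rankVariation (fun j : Fin (m + 1) => (z j ω).2) (σ (m + 1) ω) := by
  refine measurable_perm_apply (hσ (m + 1))
    (F := fun π ω => rankVariation (fun j : Fin (m + 1) => (z j ω).2) π) fun π => ?_
  have hr := measurable_rankLE (y := fun (j : Fin (m + 1)) ω => (z j ω).2) fun i => (hz i).snd
  exact Finset.measurable_sum _ fun i _ => ((hr _).sub (hr _)).abs

theorem tendsto_integral_abs_rankVariation [IsProbabilityMeasure ρ] (hz : ∀ i, Measurable (z i))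
    (hind : iIndepFun z P) (hρ : ∀ i, P.map (z i) = ρ)
    (hσ : ∀ n, IsUniformTieBreaking P (fun ω (i : Fin n) => (z i ω).1)
      (fun ω (i : Fin n) => (z i ω).2) (σ n))
    {h : ℝ → ℝ → ℝ} (hh : IsCondSurvival ρ h) :
    Tendsto (fun m : ℕ => ∫ ω, |rankVariation (fun j : Fin (m + 1) => (z j ω).2) (σ (m + 1) ω) /
      ((m : ℝ) + 1) ^ 2 - ∫ t, incrementLimit ρ h t ∂(ρ.map Prod.snd)| ∂P) atTop (𝓝 0) := by
  have := Measure.isProbabilityMeasure_map (μ := ρ) (measurable_snd (α := ℝ) (β := ℝ)).aemeasurable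
  set μ := ρ.map Prod.snd with hμdef
  have hμ : ∀ i, P.map (fun ω => (z i ω).2) = μ := fun i => by
    rw [hμdef, ← hρ i, Measure.map_map measurable_snd (hz i)]
    rfl
  have hlim := tendsto_integral_integral_abs_sqIncrements hz hind hρ hσ hh μ
  have hlim2 : Tendsto (fun m : ℕ => 2 * ((√((m : ℝ) + 1))⁻¹ + ((m : ℝ) + 1)⁻¹) +
      ∫ ω, ∫ t, |sqIncrements z σ m t ω / (m + 1) - incrementLimit ρ h t| ∂μ ∂P)
      atTop (𝓝 0) := by
    simpa using ((tendsto_add_one_inv_sqrt.add tendsto_add_one_inv).const_mul 2).add hlim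
  refine squeeze_zero (fun m => integral_nonneg fun _ => abs_nonneg _) (fun m => ?_) hlim2
  have hn : (0 : ℝ) < (m : ℝ) + 1 := by positivity
  have hy : ∀ i : Fin (m + 1), Measurable fun ω => (z i ω).2 := fun i => (hz i).snd
  have hyind : iIndepFun (fun (i : Fin (m + 1)) ω => (z i ω).2) P :=
    (hind.comp (fun _ => Prod.snd) fun _ => measurable_snd).precomp Fin.val_injective
  have hrank := integral_abs_rankLE_sub_le hy hyind fun i => hμ i
  set e : Fin (m + 1) → Ω → ℝ := fun i ω => |(rankLE (fun j : Fin (m + 1) => (z j ω).2) i : ℝ) -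
      (m + 1) * ∫ t, leInd t (z i ω).2 ∂μ| with he
  have hei : ∀ i, Integrable (e i) P := fun i =>
    integrable_of_abs_le (C := (m + 1))
      (((measurable_rankLE hy i).sub
        ((measurable_integral_leInd_left.comp (hy i)).const_mul _)).abs) fun ω => by
      have h0 : (rankLE (fun j : Fin (m + 1) => (z j ω).2) i : ℝ) ≤ m + 1 := by
        exact_mod_cast rankLE_le _ i
      have h1 : (0 : ℝ) ≤ rankLE (fun j : Fin (m + 1) => (z j ω).2) i := Nat.cast_nonneg _
      have h2 := integral_leInd_left_mem (μ := μ) (z i ω).2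
      have h3 := mul_le_mul_of_nonneg_left h2.2 hn.le
      have h4 := mul_nonneg hn.le h2.1
      rw [abs_abs]
      exact abs_le.2 ⟨by linarith, by linarith⟩
  have hsi : Integrable (fun ω => 2 * ((∑ i, e i ω) / ((m : ℝ) + 1) ^ 2)) P :=
    ((integrable_finsetSum _ fun i _ => hei i).div_const _).const_mul _
  have hmeas : Measurable fun p : Ω × ℝ =>
      |sqIncrements z σ m p.2 p.1 / (m + 1) - incrementLimit ρ h p.2| :=
    ((((measurable_sqIncrements hz (fun n π => (hσ n π).1) m).comp measurable_swap).div_const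
      _).sub (hh.measurable_incrementLimit.comp measurable_snd)).abs
  have hii : Integrable (fun ω => ∫ t, |sqIncrements z σ m t ω / (m + 1) - incrementLimit ρ h t| ∂μ)
      P :=
    (integrable_of_abs_le (P := P.prod μ) (C := 3) hmeas fun p => by
      have h1 := abs_sqIncrements_div_le (z := z) (σ := σ) m p.2 p.1
      have h2 := hh.abs_incrementLimit_le p.2
      have h3 := abs_sub (sqIncrements z σ m p.2 p.1 / (m + 1)) (incrementLimit ρ h p.2)
      rw [abs_abs]
      linarith).integral_prod_left
  refine (integral_mono_of_nonneg (ae_of_all _ fun _ => abs_nonneg _) (hsi.add hii)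
    (ae_of_all _ fun ω => abs_rankVariation_sub_le hh m ω)).trans ?_
  rw [integral_add' hsi hii, integral_const_mul, integral_div,
    integral_finsetSum _ fun i _ => hei i]
  have h5 : ∑ i, ∫ ω, e i ω ∂P ≤ (m + 1) * (√(m + 1) + 1) := by
    refine (Finset.sum_le_sum fun i _ => hrank i).trans_eq ?_
    rw [Finset.sum_const, Finset.card_univ, Fintype.card_fin, nsmul_eq_mul]
    push_cast
    rfl
  gcongr
  calc _ ≤ (m + 1) * (√((m : ℝ) + 1) + 1) / (m + 1) ^ 2 := by gcongr
    _ = √((m : ℝ) + 1) / (m + 1) + ((m : ℝ) + 1)⁻¹ := by field_simp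
    _ = _ := by rw [sqrt_div_self_add_one]

end Limits

/-! ### The population quantity in terms of the limits. -/

theorem indicator_le_eq_leInd {Ω : Type*} {Y : Ω → ℝ} (t : ℝ) :
    Set.indicator {ω | t ≤ Y ω} (fun _ => (1 : ℝ)) = fun ω => leInd t (Y ω) := by
  ext ω
  simp [leInd, Set.indicator]

theorem integral_leInd_comp {Ω : Type*} [MeasurableSpace Ω] {P : Measure Ω} {Y : Ω → ℝ}
    (hY : Measurable Y) (t : ℝ) :
    ∫ ω, leInd t (Y ω) ∂P = ∫ s, leInd t s ∂(P.map Y) :=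
  (integral_map hY.aemeasurable (measurable_leInd_comp measurable_const
    measurable_id).aestronglyMeasurable).symm

theorem map_snd_map_prodMk {Ω : Type*} [MeasurableSpace Ω] {P : Measure Ω} {X Y : Ω → ℝ}
    (hX : Measurable X) (hY : Measurable Y) :
    (P.map fun ω => (X ω, Y ω)).map Prod.snd = P.map Y := by
  rw [Measure.map_map measurable_snd (hX.prodMk hY)]
  rfl

section Population

variable {Ω : Type*} [MeasurableSpace Ω] {P : Measure Ω} [IsProbabilityMeasure P] {X Y : Ω → ℝ}

theorem leInd_eq_indicator (t : ℝ) : leInd t = (Set.Ici t).indicator 1 := by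
  ext y
  simp [leInd, Set.indicator]

/-- The conditional survival function `P(Y ≥ t | X = x)`. -/
noncomputable def condSurvival (P : Measure Ω) [IsFiniteMeasure P] (X Y : Ω → ℝ) (t x : ℝ) : ℝ :=
  (condDistrib Y X P x).real (Set.Ici t)

theorem integral_leInd_eq_real {ν : Measure ℝ} (t : ℝ) :
    ∫ y, leInd t y ∂ν = ν.real (Set.Ici t) := by
  rw [leInd_eq_indicator, integral_indicator_one measurableSet_Ici]

theorem isCondSurvival_condSurvival (hX : Measurable X) (hY : Measurable Y) :
    IsCondSurvival (P.map fun ω => (X ω, Y ω)) (condSurvival P X Y) where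
  measurable := by
    -- Joint measurability in `(t, x)`: the half-lines are the sections of this one measurable set.
    have hs : MeasurableSet {q : (ℝ × ℝ) × ℝ | q.1.1 ≤ q.2} :=
      measurableSet_le measurable_fst.fst measurable_snd
    exact (Kernel.measurable_kernel_prodMk_left
      (κ := (condDistrib Y X P).comap Prod.snd measurable_snd) hs).ennreal_toReal
  mem t x := ⟨measureReal_nonneg, measureReal_le_one⟩
  integral_mul t ψ hψ := by
    rintro ⟨C, hC⟩
    have hm : Measurable fun x => condSurvival P X Y t x :=
      ((condDistrib Y X P).measurable_coe measurableSet_Ici).ennreal_toReal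
    have := Measure.isProbabilityMeasure_map (μ := P) hX.aemeasurable
    rw [← compProd_map_condDistrib hY.aemeasurable, Measure.integral_compProd]
    · refine integral_eq_zero_of_ae (ae_of_all _ fun x => ?_)
      simp only [Pi.zero_apply]
      have hli : Integrable (leInd t) (condDistrib Y X P x) :=
        integrable_of_abs_le (measurable_leInd_comp measurable_const measurable_id)
          fun y => abs_le_one_of_mem (leInd_mem _ _)
      rw [integral_const_mul, integral_sub hli (integrable_const _), integral_leInd_eq_real]
      simp [condSurvival]
    · refine integrable_of_abs_le (C := C) ((hψ.comp measurable_fst).mul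
        ((measurable_leInd_comp measurable_const measurable_snd).sub
          (hm.comp measurable_fst))) fun s => ?_
      rw [abs_mul]
      exact (mul_le_of_le_one_right (abs_nonneg _) (abs_sub_le_one_of_mem (leInd_mem _ _)
        ⟨measureReal_nonneg, measureReal_le_one⟩)).trans (hC _)

theorem variance_of_mem {f : Ω → ℝ} (hf : Measurable f) (h : ∀ ω, f ω ∈ Set.Icc (0 : ℝ) 1) :
    variance f P = ∫ ω, f ω ^ 2 ∂P - (∫ ω, f ω ∂P) ^ 2 := by
  rw [variance_eq_sub (MemLp.of_bound hf.aestronglyMeasurable 1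
    (ae_of_all _ fun ω => abs_le_one_of_mem (h ω)))]
  rfl

theorem variance_indicator_le (hY : Measurable Y) (t : ℝ) :
    variance (Set.indicator {ω | t ≤ Y ω} (fun _ => (1 : ℝ))) P =
      (∫ s, leInd t s ∂(P.map Y)) * (1 - ∫ s, leInd t s ∂(P.map Y)) := by
  rw [indicator_le_eq_leInd, variance_of_mem (measurable_leInd_comp measurable_const hY)
    fun ω => leInd_mem _ _]
  simp_rw [leInd_sq]
  rw [integral_leInd_comp hY]
  ring

theorem variance_condExp_indicator_le (hX : Measurable X) (hY : Measurable Y) (t : ℝ) :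
    variance (P[Set.indicator {ω | t ≤ Y ω} (fun _ => (1 : ℝ)) |
      MeasurableSpace.comap X inferInstance]) P =
      ∫ s, condSurvival P X Y t s.1 ^ 2 ∂(P.map fun ω => (X ω, Y ω)) -
        (∫ s, leInd t s ∂(P.map Y)) ^ 2 := by
  have hm : Measurable fun x => condSurvival P X Y t x :=
    ((condDistrib Y X P).measurable_coe measurableSet_Ici).ennreal_toReal
  have hae : (fun ω => condSurvival P X Y t (X ω)) =ᵐ[P]
      P[Set.indicator {ω | t ≤ Y ω} (fun _ => (1 : ℝ)) |
        MeasurableSpace.comap X inferInstance] :=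
    condDistrib_ae_eq_condExp hX hY measurableSet_Ici
  rw [← variance_congr hae, variance_of_mem
    (f := fun ω => condSurvival P X Y t (X ω)) (hm.comp hX)
    fun ω => ⟨measureReal_nonneg, measureReal_le_one⟩, integral_congr_ae hae,
    integral_condExp hX.comap_le, indicator_le_eq_leInd, integral_leInd_comp hY,
    integral_map (hX.prodMk hY).aemeasurable]
  exact ((hm.comp measurable_fst).pow_const 2).aestronglyMeasurable

/-- This holds for each `t` before integration: with `p = P(Y ≥ t)` and `q` the mean of the squared
conditional survival function, `2p(1 - p) - 2(p - q) = 2(q - p²)`. It identifies the limit of the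
estimator with the population quantity. -/
theorem two_mul_spreadLimit_sub (hX : Measurable X) (hY : Measurable Y) :
    2 * spreadLimit (P.map Y) -
      ∫ t, incrementLimit (P.map fun ω => (X ω, Y ω)) (condSurvival P X Y) t ∂(P.map Y) =
    2 * ∫ t, variance (P[Set.indicator {ω | t ≤ Y ω} (fun _ => (1 : ℝ)) |
      MeasurableSpace.comap X inferInstance]) P ∂(P.map Y) := by
  have := Measure.isProbabilityMeasure_map (μ := P) hY.aemeasurable
  have := Measure.isProbabilityMeasure_map (μ := P) (hX.prodMk hY).aemeasurable
  have hh := isCondSurvival_condSurvival (P := P) hX hY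
  have hGm : Measurable fun t => ∫ s, leInd t s ∂(P.map Y) := measurable_integral_leInd_right
  have hG1 : ∀ t, ∫ s, leInd t s ∂(P.map Y) ∈ Set.Icc (0 : ℝ) 1 := integral_leInd_right_mem
  have hS : Integrable (fun t => (∫ s, leInd t s ∂(P.map Y)) *
      (1 - ∫ s, leInd t s ∂(P.map Y))) (P.map Y) :=
    integrable_of_abs_le (hGm.mul (hGm.const_sub 1)) fun t =>
      abs_le_one_of_mem (mul_one_sub_mem (hG1 t))
  have hI : Integrable (incrementLimit (P.map fun ω => (X ω, Y ω)) (condSurvival P X Y))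
      (P.map Y) := integrable_of_abs_le hh.measurable_incrementLimit hh.abs_incrementLimit_le
  rw [spreadLimit, ← integral_const_mul, ← integral_const_mul,
    ← integral_sub (hS.const_mul 2) hI]
  refine integral_congr_ae (ae_of_all _ fun t => ?_)
  have hmarg : ∫ s, leInd t s.2 ∂(P.map fun ω => (X ω, Y ω)) = ∫ s, leInd t s ∂(P.map Y) := by
    rw [← map_snd_map_prodMk hX hY, integral_map measurable_snd.aemeasurable]
    exact (measurable_leInd_comp measurable_const measurable_id).aestronglyMeasurable
  simp only [incrementLimit]
  rw [variance_condExp_indicator_le hX hY, hmarg]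
  ring

theorem xiPop_eq (hX : Measurable X) (hY : Measurable Y) :
    xiPop P X Y = (2 * spreadLimit (P.map Y) -
      ∫ t, incrementLimit (P.map fun ω => (X ω, Y ω)) (condSurvival P X Y) t ∂(P.map Y)) /
        (2 * spreadLimit (P.map Y)) := by
  rw [two_mul_spreadLimit_sub hX hY, mul_div_mul_left _ _ two_ne_zero, xiPop, spreadLimit]
  simp_rw [variance_indicator_le hY]

theorem two_mul_spreadLimit_sub_nonneg (hX : Measurable X) (hY : Measurable Y) :
    0 ≤ 2 * spreadLimit (P.map Y) -
      ∫ t, incrementLimit (P.map fun ω => (X ω, Y ω)) (condSurvival P X Y) t ∂(P.map Y) := by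
  rw [two_mul_spreadLimit_sub hX hY]
  exact mul_nonneg two_pos.le (integral_nonneg fun t => variance_nonneg _ _)

/-- The set `N` of exceptional `t` is closed upwards. If it has a least element it lies in one null
half-line; otherwise it is covered by the countably many null half-lines that start at rational
points of `N`. -/
theorem ae_measure_Ici_ne_zero (μ : Measure ℝ) : ∀ᵐ t ∂μ, μ (Set.Ici t) ≠ 0 := by
  set N : Set ℝ := {t | μ (Set.Ici t) = 0} with hN
  suffices h : μ N = 0 by
    rw [ae_iff]
    simpa using h
  by_cases hmin : ∃ t₀ ∈ N, ∀ t ∈ N, t₀ ≤ t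
  · obtain ⟨t₀, ht₀, hle⟩ := hmin
    exact measure_mono_null hle ht₀
  · push Not at hmin
    have hsub : N ⊆ ⋃ q : {q : ℚ // (q : ℝ) ∈ N}, Set.Ici ((q : ℚ) : ℝ) := fun t ht => by
      obtain ⟨t', ht', hlt⟩ := hmin t ht
      obtain ⟨q, hq1, hq2⟩ := exists_rat_btwn hlt
      have hqN : (q : ℝ) ∈ N := measure_mono_null (Set.Ici_subset_Ici.2 hq1.le) ht'
      exact Set.mem_iUnion.2 ⟨⟨q, hqN⟩, hq2.le⟩
    exact measure_mono_null hsub (measure_iUnion_null fun q => q.2)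

/-- If the integral vanishes, `μ [t, ∞)` is 0 or 1 for almost every `t`, and 0 is excluded almost
everywhere. So `t ≤ s` for almost every `t` and then almost every `s`; exchanging the quantifiers
yields a point `c` that bounds almost every `s` from both sides. -/
theorem spreadLimit_pos {μ : Measure ℝ} [IsProbabilityMeasure μ]
    (hμ : ¬ ∃ c : ℝ, ∀ᵐ y ∂μ, y = c) : 0 < spreadLimit μ := by
  have hm : ∀ t, ∫ s, leInd t s ∂μ ∈ Set.Icc (0 : ℝ) 1 := integral_leInd_right_mem
  have hnn : ∀ t, 0 ≤ (∫ s, leInd t s ∂μ) * (1 - ∫ s, leInd t s ∂μ) := fun t =>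
    (mul_one_sub_mem (hm t)).1
  refine lt_of_le_of_ne (integral_nonneg hnn) fun h0 => hμ ?_
  have hmeas : Measurable fun t => ∫ s, leInd t s ∂μ := measurable_integral_leInd_right
  have hae := (integral_eq_zero_iff_of_nonneg hnn (integrable_of_abs_le (C := 1)
    (hmeas.mul (hmeas.const_sub 1)) fun t => abs_le_one_of_mem (mul_one_sub_mem (hm t)))).1 h0.symm
  have hle : ∀ᵐ t ∂μ, ∀ᵐ s ∂μ, t ≤ s := by
    filter_upwards [hae, ae_measure_Ici_ne_zero μ] with t ht hne
    rw [integral_leInd_eq_real, Pi.zero_apply, mul_eq_zero, sub_eq_zero] at ht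
    rcases ht with ht | ht
    · exact absurd ((measureReal_eq_zero_iff).1 ht) hne
    · have h1 : μ (Set.Ici t) = 1 := by
        rw [← ENNReal.toReal_eq_one_iff]
        exact ht.symm
      exact (prob_compl_eq_zero_iff measurableSet_Ici).2 h1
  have hge := (Measure.ae_ae_comm (measurableSet_le measurable_fst measurable_snd)).1 hle
  obtain ⟨c, hc1, hc2⟩ := (hle.and hge).exists
  refine ⟨c, ?_⟩
  filter_upwards [hc1, hc2] with s h1 h2
  exact le_antisymm h2 h1

end Population

/-! ### Pointwise error bound for the normalized estimator. -/

/-- Stability of the normalized ratio. -/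
theorem abs_max_neg_one_div_sub_le {a b α β : ℝ} (hab : a ≤ b) (hb : 0 < b) (hα : 0 ≤ α)
    (hβ : 0 < β) : |max (-1) (a / b) - α / β| ≤ (|β - b| + |a - α|) / β := by
  have hβ' := hβ.ne'
  have h : max (-1) (a / b) - α / β = (max (-1) (a / b) * β - α) / β := by field_simp
  rw [h, abs_div, abs_of_pos hβ]
  gcongr
  rcases le_total (-1) (a / b) with h1 | h1
  · rw [max_eq_right h1]
    -- The coefficient `a / b` of `β - b` lies in `[-1, 1]`, so no lower bound on `b` is needed.
    have h2 : a / b * β - α = a / b * (β - b) + (a - α) := by field_simp; ring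
    rw [h2]
    refine (abs_add_le _ _).trans (add_le_add ?_ le_rfl)
    rw [abs_mul]
    exact mul_le_of_le_one_left (abs_nonneg _) (abs_le.2 ⟨h1, (div_le_one hb).2 hab⟩)
  · rw [max_eq_left h1]
    rw [div_le_iff₀ hb] at h1
    have h2 := le_abs_self (β - b)
    have h3 := neg_abs_le (a - α)
    exact abs_le.2 ⟨by linarith, by linarith [abs_nonneg (β - b), abs_nonneg (a - α)]⟩

theorem rankSpread_eq_zero {n : ℕ} {y : Fin n → ℝ} (hy : ¬ NotAllEqual y) : rankSpread y = 0 := by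
  have heq : ∀ i j, y i = y j := by simpa [NotAllEqual] using hy
  refine Finset.sum_eq_zero fun i _ => ?_
  rw [rankGE_eq_sum]
  have hle : ∀ j, y i ≤ y j := fun j => (heq i j).le
  simp [hle]

/-- The error bound that controls the estimator. -/
noncomputable def errorBound {m : ℕ} (D V : ℝ) (y : Fin (m + 1) → ℝ)
    (σ : Equiv.Perm (Fin (m + 1))) : ℝ :=
  (4 * |rankSpread y / ((m : ℝ) + 1) ^ 3 - D| + |rankVariation y σ / ((m : ℝ) + 1) ^ 2 - V| +
    ((m : ℝ) + 1)⁻¹) / (2 * D)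

theorem errorBound_nonneg {m : ℕ} {D V : ℝ} (hD : 0 < D) (y : Fin (m + 1) → ℝ)
    (σ : Equiv.Perm (Fin (m + 1))) : 0 ≤ errorBound D V y σ := by
  unfold errorBound
  positivity

/-- On constant samples the spread vanishes, so the first term of the numerator alone is `4 * D`.
Hence the expected error bound also dominates the probability of such samples. -/
theorem one_le_errorBound {m : ℕ} {D V : ℝ} (hD : 0 < D) {y : Fin (m + 1) → ℝ}
    (hy : ¬ NotAllEqual y) (σ : Equiv.Perm (Fin (m + 1))) : 1 ≤ errorBound D V y σ := by
  rw [errorBound, rankSpread_eq_zero hy, zero_div, zero_sub, abs_neg, abs_of_pos hD,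
    one_le_div (by positivity)]
  have h1 := abs_nonneg (rankVariation y σ / ((m : ℝ) + 1) ^ 2 - V)
  have h2 : (0 : ℝ) ≤ ((m : ℝ) + 1)⁻¹ := by positivity
  linarith

/-- Numerator and denominator of the ratio are divided by `(m + 1) ^ 3`. Each contains the spread
with factor 2, hence the 4 in `errorBound`; the sorted variation is at most `m + 1` and gives the
term `(m + 1)⁻¹`. -/
theorem abs_xiNormalized_sub_le {m : ℕ} (hm : 2 < m + 1) {D V : ℝ} (hD : 0 < D)
    (hV : 0 ≤ 2 * D - V) {y : Fin (m + 1) → ℝ} (hy : NotAllEqual y)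
    (σ : Equiv.Perm (Fin (m + 1))) :
    |xiNormalized y σ - (2 * D - V) / (2 * D)| ≤ errorBound D V y σ := by
  have hn : (0 : ℝ) < (m : ℝ) + 1 := by positivity
  have h1 := mul_rankVariation_sort_lt hm y hy
  have h2 := mul_le_mul_of_nonneg_left (rankVariation_sort_le y σ) hn.le
  have h3 := rankVariation_sort_le_card y
  have h4 := rankVariation_nonneg y (Tuple.sort y)
  rw [xiNormalized_eq hm y hy]
  push_cast at h1 h3 ⊢
  set a := 2 * (rankSpread y / ((m : ℝ) + 1) ^ 3) - rankVariation y σ / ((m : ℝ) + 1) ^ 2 with ha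
  set b := 2 * (rankSpread y / ((m : ℝ) + 1) ^ 3) -
    rankVariation y (Tuple.sort y) / ((m : ℝ) + 1) ^ 2 with hb
  have ha' : 2 * rankSpread y - ((m : ℝ) + 1) * rankVariation y σ = a * (m + 1) ^ 3 := by
    rw [ha]; field_simp
  have hb' : 2 * rankSpread y - ((m : ℝ) + 1) * rankVariation y (Tuple.sort y) =
      b * (m + 1) ^ 3 := by
    rw [hb]; field_simp
  rw [ha', hb', mul_div_mul_right _ _ (by positivity)]
  have hbpos : 0 < b := by
    have : 0 < b * ((m : ℝ) + 1) ^ 3 := by rw [← hb']; linarith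
    exact pos_of_mul_pos_left this (by positivity)
  have hab : a ≤ b := by
    rw [ha, hb]
    gcongr
    exact rankVariation_sort_le y σ
  refine (abs_max_neg_one_div_sub_le hab hbpos hV (by positivity)).trans ?_
  refine div_le_div_of_nonneg_right ?_ (by positivity)
  set d := rankSpread y / ((m : ℝ) + 1) ^ 3 - D with hd
  set v := rankVariation y σ / ((m : ℝ) + 1) ^ 2 - V with hv
  have hS : rankVariation y (Tuple.sort y) / ((m : ℝ) + 1) ^ 2 ≤ ((m : ℝ) + 1)⁻¹ := by
    rw [div_le_iff₀ (by positivity)]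
    refine h3.trans_eq ?_
    field_simp
  have hS0 : 0 ≤ rankVariation y (Tuple.sort y) / ((m : ℝ) + 1) ^ 2 := by positivity
  have e1 : |2 * D - b| ≤ 2 * |d| + ((m : ℝ) + 1)⁻¹ := by
    have := abs_le.1 (le_refl |d|)
    exact abs_le.2 ⟨by rw [hb]; linarith, by rw [hb]; linarith⟩
  have e2 : |a - (2 * D - V)| ≤ 2 * |d| + |v| := by
    have := abs_le.1 (le_refl |d|)
    have := abs_le.1 (le_refl |v|)
    exact abs_le.2 ⟨by rw [ha]; linarith, by rw [ha]; linarith⟩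
  linarith

/-! ### Measurability and convergence of the expected error bound. -/

section Final

variable {Ω : Type*} [MeasurableSpace Ω] {P : Measure Ω} [IsProbabilityMeasure P]

theorem measurable_rankVariation_const {m : ℕ} {y : Fin (m + 1) → Ω → ℝ}
    (hy : ∀ i, Measurable (y i)) (π : Equiv.Perm (Fin (m + 1))) :
    Measurable fun ω => rankVariation (fun i => y i ω) π :=
  Finset.measurable_sum _ fun _ _ => ((measurable_rankLE hy _).sub (measurable_rankLE hy _)).abs

/-- The sorting permutation attains the minimum of the variation over all permutations, so
measurability follows from that of a finite minimum. -/
theorem measurable_rankVariation_sort {m : ℕ} {y : Fin (m + 1) → Ω → ℝ}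
    (hy : ∀ i, Measurable (y i)) :
    Measurable fun ω => rankVariation (fun i => y i ω) (Tuple.sort fun i => y i ω) := by
  have heq : (fun ω => rankVariation (fun i => y i ω) (Tuple.sort fun i => y i ω)) =
      Finset.univ.inf' Finset.univ_nonempty
        (fun (π : Equiv.Perm (Fin (m + 1))) ω => rankVariation (fun i => y i ω) π) := by
    ext ω
    rw [Finset.inf'_apply]
    refine le_antisymm (Finset.le_inf' _ _ fun π _ => rankVariation_sort_le _ _)
      (Finset.inf'_le (fun π => rankVariation (fun i => y i ω) π) (Finset.mem_univ _))
  rw [heq]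
  exact Finset.inf'_induction (p := Measurable) _ _ (fun _ hf _ hg => hf.inf hg)
    fun π _ => measurable_rankVariation_const hy π

theorem measurable_xiNormalized {m : ℕ} {y : Fin (m + 1) → Ω → ℝ} (hy : ∀ i, Measurable (y i))
    {σ : Ω → Equiv.Perm (Fin (m + 1))} (hσ : ∀ π, MeasurableSet {ω | σ ω = π}) :
    Measurable fun ω => xiNormalized (fun i => y i ω) (σ ω) := by
  refine measurable_perm_apply hσ (F := fun π ω => xiNormalized (fun i => y i ω) π) fun π => ?_
  simp only [xiNormalized, xiSelf, xiN_eq]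
  have hs := (measurable_rankSpread hy).const_mul 2
  have h1 := measurable_rankVariation_const hy π
  have h2 := measurable_rankVariation_sort hy
  exact measurable_const.max ((((h1.const_mul _).div hs).const_sub 1).div
    (((h2.const_mul _).div hs).const_sub 1))

theorem measurableSet_notAllEqual {n : ℕ} {y : Fin n → Ω → ℝ} (hy : ∀ i, Measurable (y i)) :
    MeasurableSet {ω | NotAllEqual fun i => y i ω} := by
  have : {ω | NotAllEqual fun i => y i ω} = ⋃ i, ⋃ j, {ω | y i ω = y j ω}ᶜ := by
    ext ω
    simp [NotAllEqual]
  rw [this]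
  exact MeasurableSet.iUnion fun i => MeasurableSet.iUnion fun j =>
    (measurableSet_eq_fun (hy i) (hy j)).compl

theorem tendsto_integral_of_abs_sub_le {F U : ℕ → Ω → ℝ} {θ C : ℝ}
    (hF : ∀ᶠ m in atTop, Integrable (F m) P) (hU : ∀ m, Integrable (U m) P)
    (hU0 : Tendsto (fun m => ∫ ω, U m ω ∂P) atTop (𝓝 0))
    (hFU : ∀ᶠ m in atTop, ∀ ω, |F m ω - θ| ≤ C * U m ω) :
    Tendsto (fun m => ∫ ω, F m ω ∂P) atTop (𝓝 θ) := by
  rw [tendsto_iff_norm_sub_tendsto_zero]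
  have hC : Tendsto (fun m => C * ∫ ω, U m ω ∂P) atTop (𝓝 0) := by simpa using hU0.const_mul C
  refine squeeze_zero' (Eventually.of_forall fun m => norm_nonneg _) ?_ hC
  filter_upwards [hF, hFU] with m h1 h2
  have h3 : ∫ ω, F m ω ∂P - θ = ∫ ω, (F m ω - θ) ∂P := by
    rw [integral_sub h1 (integrable_const _)]
    simp
  rw [h3, ← integral_const_mul]
  exact norm_integral_le_of_norm_le ((hU m).const_mul C) (ae_of_all _ h2)

theorem errorBound_tendsto {z : ℕ → Ω → ℝ × ℝ} {ρ : Measure (ℝ × ℝ)}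
    {σ : (n : ℕ) → Ω → Equiv.Perm (Fin n)} [IsProbabilityMeasure ρ] (hz : ∀ i, Measurable (z i))
    (hind : iIndepFun z P) (hρ : ∀ i, P.map (z i) = ρ)
    (hσ : ∀ n, IsUniformTieBreaking P (fun ω (i : Fin n) => (z i ω).1)
      (fun ω (i : Fin n) => (z i ω).2) (σ n))
    {h : ℝ → ℝ → ℝ} (hh : IsCondSurvival ρ h) :
    (∀ m : ℕ, Integrable (fun ω => errorBound (spreadLimit (ρ.map Prod.snd))
      (∫ t, incrementLimit ρ h t ∂(ρ.map Prod.snd)) (fun j : Fin (m + 1) => (z j ω).2)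
      (σ (m + 1) ω)) P) ∧
    Tendsto (fun m : ℕ => ∫ ω, errorBound (spreadLimit (ρ.map Prod.snd))
      (∫ t, incrementLimit ρ h t ∂(ρ.map Prod.snd)) (fun j : Fin (m + 1) => (z j ω).2)
      (σ (m + 1) ω) ∂P) atTop (𝓝 0) := by
  have := Measure.isProbabilityMeasure_map (μ := ρ) (measurable_snd (α := ℝ) (β := ℝ)).aemeasurable
  set μ := ρ.map Prod.snd with hμdef
  have hμ : ∀ i, P.map (fun ω => (z i ω).2) = μ := fun i => by
    rw [hμdef, ← hρ i, Measure.map_map measurable_snd (hz i)]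
    rfl
  have hS := tendsto_integral_abs_rankSpread (y := fun i ω => (z i ω).2) (fun i => (hz i).snd)
    (hind.comp (fun _ => Prod.snd) fun _ => measurable_snd) hμ
  have hR := tendsto_integral_abs_rankVariation hz hind hρ hσ hh
  rw [← hμdef] at hR
  set D := spreadLimit μ
  set V := ∫ t, incrementLimit ρ h t ∂μ
  have hrS : ∀ m : ℕ, Integrable (fun ω =>
      |rankSpread (fun j : Fin (m + 1) => (z j ω).2) / ((m : ℝ) + 1) ^ 3 - D|) P := fun m => by
    have hrk : ∀ i ω, (rankGE (fun j : Fin (m + 1) => (z j ω).2) i : ℝ) ∈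
        Set.Icc (0 : ℝ) ((m + 1 : ℕ) : ℝ) := fun i ω =>
      ⟨Nat.cast_nonneg _, by exact_mod_cast rankGE_le _ i⟩
    have hm := fun i => measurable_rankGE (y := fun (j : Fin (m + 1)) ω => (z j ω).2)
      (fun j => (hz j).snd) i
    refine (((integrable_finsetSum _ fun i _ => ?_).div_const _).sub (integrable_const D)).abs
    refine integrable_of_abs_le (C := ((m + 1 : ℕ) : ℝ) * ((m + 1 : ℕ) : ℝ))
      ((hm i).mul ((hm i).const_sub _)) fun ω => ?_
    rw [abs_mul]
    have := hrk i ω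
    rw [Set.mem_Icc] at this
    gcongr
    · rw [abs_of_nonneg this.1]; exact this.2
    · exact abs_le.2 ⟨by linarith, by linarith⟩
  have hrV : ∀ m : ℕ, Integrable (fun ω =>
      |rankVariation (fun j : Fin (m + 1) => (z j ω).2) (σ (m + 1) ω) / ((m : ℝ) + 1) ^ 2 - V|)
      P := fun m => by
    have hb : ∀ ω, |rankVariation (fun j : Fin (m + 1) => (z j ω).2) (σ (m + 1) ω)| ≤
        ∑ _i : Fin m, ((m + 1 : ℕ) : ℝ) := fun ω => by
      rw [abs_of_nonneg (rankVariation_nonneg _ _)]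
      refine Finset.sum_le_sum fun i _ => ?_
      have hle : ∀ i, (rankLE (fun j : Fin (m + 1) => (z j ω).2) i : ℝ) ≤ ((m + 1 : ℕ) : ℝ) :=
        fun i => Nat.cast_le.2 (rankLE_le _ i)
      have h0 : ∀ i, (0 : ℝ) ≤ rankLE (fun j : Fin (m + 1) => (z j ω).2) i := fun i =>
        Nat.cast_nonneg _
      exact abs_le.2 ⟨by linarith [h0 (σ (m + 1) ω i.succ), hle (σ (m + 1) ω i.castSucc)],
        by linarith [hle (σ (m + 1) ω i.succ), h0 (σ (m + 1) ω i.castSucc)]⟩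
    exact (((integrable_of_abs_le (measurable_rankVariation hz (fun n π => (hσ n π).1) m)
      hb).div_const _).sub (integrable_const V)).abs
  have hI4 := fun m => (hrS m).const_mul 4
  have hI2 := fun m => (hI4 m).add (hrV m)
  refine ⟨fun m => ((hI2 m).add (integrable_const _)).div_const _, ?_⟩
  have hlim : Tendsto (fun m : ℕ =>
      (4 * ∫ ω, |rankSpread (fun j : Fin (m + 1) => (z j ω).2) / ((m : ℝ) + 1) ^ 3 - D| ∂P +
      ∫ ω, |rankVariation (fun j : Fin (m + 1) => (z j ω).2) (σ (m + 1) ω) / ((m : ℝ) + 1) ^ 2 -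
        V| ∂P + ((m : ℝ) + 1)⁻¹) / (2 * D)) atTop (𝓝 0) := by
    simpa using (((hS.const_mul 4).add hR).add tendsto_add_one_inv).div_const (2 * D)
  refine hlim.congr fun m => ?_
  simp only [errorBound]
  rw [integral_div]
  congr 1
  have e1 := integral_add' (hI2 m) (integrable_const (μ := P) (((m : ℝ) + 1)⁻¹))
  have e2 := integral_add' (hI4 m) (hrV m)
  simp only [Pi.add_apply] at e1 e2
  rw [e1, e2, integral_const_mul]
  simp

end Final

/-! ### Asymptotic unbiasedness, conditional and unconditional. -/

theorem eventually_atTop_of_add_one {p : ℕ → Prop} (h : ∀ᶠ m in atTop, p (m + 1)) :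
    ∀ᶠ n in atTop, p n := by
  obtain ⟨N, hN⟩ := eventually_atTop.1 h
  refine eventually_atTop.2 ⟨N + 1, fun n hn => ?_⟩
  obtain ⟨k, rfl⟩ : ∃ k, n = k + 1 := ⟨n - 1, by omega⟩
  exact hN k (by omega)

theorem integral_cond_eq {Ω : Type*} [MeasurableSpace Ω] {P : Measure Ω} {s : Set Ω}
    (hs : MeasurableSet s) (T : Ω → ℝ) :
    ∫ ω, T ω ∂(P[|s]) = (∫ ω, s.indicator (fun _ => (1 : ℝ)) ω ∂P)⁻¹ *
      ∫ ω, s.indicator T ω ∂P := by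
  rw [ProbabilityTheory.cond, integral_smul_measure, integral_indicator hs, integral_indicator hs,
    ENNReal.toReal_inv, smul_eq_mul]
  simp [Measure.real]

section Unbiased

variable {Ω' : Type*} [MeasurableSpace Ω'] {P' : Measure Ω'} [IsProbabilityMeasure P']
  {X Y : Ω' → ℝ} {Ω : Type*} [MeasurableSpace Ω] {P : Measure Ω} [IsProbabilityMeasure P]
  {z : ℕ → Ω → ℝ × ℝ} {σ : (n : ℕ) → Ω → Equiv.Perm (Fin n)}

/-- The estimator converges in `L¹`: its error is dominated by random variables whose
expectations vanish in the limit, and these exceed `1` on constant samples. -/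
theorem exists_errorBound (hX : Measurable X) (hY : Measurable Y)
    (hconst : ¬ ∃ c : ℝ, ∀ᵐ ω ∂P', Y ω = c) (hz : ∀ i, Measurable (z i)) (hind : iIndepFun z P)
    (hid : ∀ i, IdentDistrib (z i) (fun ω => (X ω, Y ω)) P P')
    (hσ : ∀ n, IsUniformTieBreaking P (fun ω (i : Fin n) => (z i ω).1)
      (fun ω (i : Fin n) => (z i ω).2) (σ n)) :
    ∃ U : ℕ → Ω → ℝ, (∀ m, Integrable (U m) P) ∧
      Tendsto (fun m => ∫ ω, U m ω ∂P) atTop (𝓝 0) ∧ (∀ m ω, 0 ≤ U m ω) ∧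
      (∀ m ω, ¬ NotAllEqual (fun i : Fin (m + 1) => (z i ω).2) → 1 ≤ U m ω) ∧
      ∀ m, 2 < m + 1 → ∀ ω, NotAllEqual (fun i : Fin (m + 1) => (z i ω).2) →
        |xiNormalized (fun i : Fin (m + 1) => (z i ω).2) (σ (m + 1) ω) - xiPop P' X Y| ≤ U m ω := by
  have := Measure.isProbabilityMeasure_map (μ := P') hY.aemeasurable
  have := Measure.isProbabilityMeasure_map (μ := P') (hX.prodMk hY).aemeasurable
  have hpos : 0 < spreadLimit (P'.map Y) := by
    refine spreadLimit_pos fun ⟨c, hc⟩ => hconst ⟨c, ?_⟩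
    exact ae_of_ae_map hY.aemeasurable hc
  obtain ⟨hint, hlim⟩ := errorBound_tendsto hz hind (fun i => (hid i).map_eq) hσ
    (isCondSurvival_condSurvival hX hY)
  rw [map_snd_map_prodMk hX hY] at hint hlim
  refine ⟨_, hint, hlim, fun m ω => errorBound_nonneg hpos _ _,
    fun m ω hω => one_le_errorBound hpos hω _, fun m hm ω hω => ?_⟩
  rw [xiPop_eq hX hY]
  exact abs_xiNormalized_sub_le hm hpos (two_mul_spreadLimit_sub_nonneg hX hY) hω _

open Classical in
theorem xiNormalized_unbiased (hX : Measurable X) (hY : Measurable Y)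
    (hconst : ¬ ∃ c : ℝ, ∀ᵐ ω ∂P', Y ω = c) (hz : ∀ i, Measurable (z i)) (hind : iIndepFun z P)
    (hid : ∀ i, IdentDistrib (z i) (fun ω => (X ω, Y ω)) P P')
    (hσ : ∀ n, IsUniformTieBreaking P (fun ω (i : Fin n) => (z i ω).1)
      (fun ω (i : Fin n) => (z i ω).2) (σ n)) :
    AsymptoticallyUnbiased (fun n => P[|{ω | NotAllEqual (fun i : Fin n => (z i ω).2)}])
        (fun n ω => xiNormalized (fun i : Fin n => (z i ω).2) (σ n ω)) (xiPop P' X Y) ∧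
      ∀ c : ℝ, AsymptoticallyUnbiased (fun _ => P)
        (fun n ω => if NotAllEqual (fun i : Fin n => (z i ω).2) then
          xiNormalized (fun i : Fin n => (z i ω).2) (σ n ω) else c) (xiPop P' X Y) := by
  obtain ⟨U, hU, hU0, hUnn, hU1, hUT⟩ := exists_errorBound hX hY hconst hz hind hid hσ
  set θ := xiPop P' X Y
  set s : (n : ℕ) → Set Ω := fun n => {ω | NotAllEqual (fun i : Fin n => (z i ω).2)} with hs
  have hsm : ∀ n, MeasurableSet (s n) := fun n =>
    measurableSet_notAllEqual (y := fun (i : Fin n) ω => (z i ω).2) fun i => (hz i).snd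
  set T : (n : ℕ) → Ω → ℝ := fun n ω => xiNormalized (fun i : Fin n => (z i ω).2) (σ n ω) with hT
  have hTm : ∀ m, Measurable (T (m + 1)) := fun m =>
    measurable_xiNormalized (y := fun (i : Fin (m + 1)) ω => (z i ω).2) (fun i => (hz i).snd)
      fun π => (hσ (m + 1) π).1
  have hT1 : ∀ m, 2 < m + 1 → ∀ ω ∈ s (m + 1), |T (m + 1) ω| ≤ 1 := fun m hm ω hω =>
    (xiNormalized_properties hm _ hω _).1
  have hev : ∀ᶠ m : ℕ in atTop, 2 < m + 1 := by
    filter_upwards [eventually_ge_atTop 2] with m hm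
    omega
  have hunc : ∀ c : ℝ, (∀ᶠ m in atTop,
        Integrable (fun ω => if ω ∈ s (m + 1) then T (m + 1) ω else c) P) ∧
      Tendsto (fun m => ∫ ω, (if ω ∈ s (m + 1) then T (m + 1) ω else c) ∂P) atTop (𝓝 θ) := by
    intro c
    have hint : ∀ᶠ m in atTop,
        Integrable (fun ω => if ω ∈ s (m + 1) then T (m + 1) ω else c) P := by
      filter_upwards [hev] with m hm
      refine integrable_of_abs_le (C := 1 + |c|)
        (Measurable.ite (hsm _) (hTm m) measurable_const) fun ω => ?_
      split_ifs with hω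
      · linarith [hT1 m hm ω hω, abs_nonneg c]
      · linarith
    -- On constant samples the error is `|c - θ|`, which is at most `|c - θ| * U` because `U ≥ 1`
    -- there.
    refine ⟨hint, tendsto_integral_of_abs_sub_le (C := 1 + |c - θ|) hint hU hU0 ?_⟩
    filter_upwards [hev] with m hm ω
    have h0 := hUnn m ω
    split_ifs with hω
    · exact (hUT m hm ω hω).trans
        (le_mul_of_one_le_left h0 (by linarith [abs_nonneg (c - θ)]))
    · have h1 := hU1 m ω hω
      nlinarith [abs_nonneg (c - θ)]
  -- The same error bound dominates the indicator of constant samples, so the probability of the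
  -- conditioning event tends to 1.
  have hone : Tendsto (fun m => ∫ ω, (s (m + 1)).indicator (fun _ => (1 : ℝ)) ω ∂P) atTop
      (𝓝 1) := by
    refine tendsto_integral_of_abs_sub_le (C := 1) (Eventually.of_forall fun m =>
      (integrable_const _).indicator (hsm _)) hU hU0 (Eventually.of_forall fun m ω => ?_)
    by_cases hω : ω ∈ s (m + 1)
    · simpa [hω] using hUnn m ω
    · simpa [hω] using hU1 m ω hω
  refine ⟨⟨eventually_atTop_of_add_one ?_, (tendsto_add_atTop_iff_nat 1).1 ?_⟩, fun c =>
    ⟨eventually_atTop_of_add_one (hunc c).1, (tendsto_add_atTop_iff_nat 1).1 (hunc c).2⟩⟩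
  · filter_upwards [hev] with m hm
    refine Integrable.of_bound (hTm m).aestronglyMeasurable 1 ?_
    filter_upwards [ae_cond_mem (hsm (m + 1))] with ω hω
    exact hT1 m hm ω hω
  -- The conditional expectation is the unconditional one with `c = 0`, divided by the probability
  -- of the event.
  · have h := (hone.inv₀ one_ne_zero).mul (hunc 0).2
    rw [inv_one, one_mul] at h
    refine h.congr fun m => ?_
    exact (integral_cond_eq (hsm (m + 1)) (T (m + 1))).symm

end Unbiased

open Classical in
theorem theorem3 :
    -- (a)
    (∀ (Ω' : Type*) [MeasurableSpace Ω'] (P' : Measure Ω') [IsProbabilityMeasure P']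
        (X Y : Ω' → ℝ) (_ : Measurable X) (_ : Measurable Y)
        (_ : ¬ ∃ c : ℝ, ∀ᵐ ω ∂P', Y ω = c)
        (Ω : Type*) [MeasurableSpace Ω] (P : Measure Ω) [IsProbabilityMeasure P]
        (x y : ℕ → Ω → ℝ) (_ : ∀ i, Measurable (x i)) (_ : ∀ i, Measurable (y i))
        (_ : iIndepFun (fun i ω => (x i ω, y i ω)) P)
        (_ : ∀ i, IdentDistrib (fun ω => (x i ω, y i ω)) (fun ω => (X ω, Y ω)) P P')
        (σ : (n : ℕ) → Ω → Equiv.Perm (Fin n))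
        (_ : ∀ n, IsUniformTieBreaking P (fun ω (i : Fin n) => x i ω)
          (fun ω (i : Fin n) => y i ω) (σ n)),
      -- expectation over the samples for which the estimator is defined
      AsymptoticallyUnbiased
          (fun n => P[|{ω | NotAllEqual (fun i : Fin n => y i ω)}])
          (fun n ω => xiNormalized (fun i : Fin n => y i ω) (σ n ω))
          (xiPop P' X Y) ∧
      -- unconditional expectation, with any value `c` on the remaining samples
      ∀ c : ℝ, AsymptoticallyUnbiased (fun _ => P)
          (fun n ω => if NotAllEqual (fun i : Fin n => y i ω) then
            xiNormalized (fun i : Fin n => y i ω) (σ n ω) else c)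
          (xiPop P' X Y)) ∧
    -- (b), (c), (d)
    (∀ (n : ℕ) (_ : 2 < n) (x y : Fin n → ℝ) (_ : NotAllEqual y)
        (σ : Equiv.Perm (Fin n)) (_ : IsOrdering x σ),
      |xiNormalized y σ| ≤ 1 ∧
      SignType.sign (xiNormalized y σ) = SignType.sign (xiN y σ) ∧
      (0 ≤ xiN y σ → xiN y σ ≤ xiNormalized y σ)) := by

  refine ⟨?_, fun n hn x y hy σ _ => xiNormalized_properties hn y hy σ⟩
  intro Ω' _ P' _ X Y hX hY hconst Ω _ P _ x y hx hy hind hid σ hσ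
  exact xiNormalized_unbiased (z := fun i ω => (x i ω, y i ω)) (σ := σ) hX hY hconst
    (fun i => (hx i).prodMk (hy i)) hind hid hσ
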